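/- Let $d\ge 2$, let $\Omega\subset\mathbb R^d$ be open, let $m\in\mathbb N=\{1,2,3,\dots\}$ and $r>0$. Let $H^m_0(\Omega)$ be the closure of $C_c^\infty(\Omega)$ in the Sobolev space $H^m(\Omega)$, and let the Dirichlet realization of $(-\Delta)^m$ be the selfadjoint operator in $L^2(\Omega)$ generated by the quadratic form $$ h^{(m)}_\Omega[u]=\begin{cases}\int_\Omega |(-\Delta)^{m/2}u|^2\,dx & \text{if } m \text{ is even},\\ \int_\Omega |\nabla(-\Delta)^{(m-1)/2}u|^2\,dx & \text{if } m\text{ is odd},\end{cases}\qquad u\in H^m_0(\Omega). $$ Let $\lambda^{(m)}_\Omega$ be the infimum of the spectrum of this operator, and let $$ \Psi_r:=\sup_{x\in\Omega}\frac{|\Omega\cap B_r(x)|}{|B_r(x)|}. $$ (If $\Omega=\emptyset$, then $\lambda^{(m)}_\Omega=+\infty$ and $\Psi_r=0$, with $0^{-s}=+\infty$ for $s>0$.) Then $$ \lambda^{(m)}_\Omega\ \ge\ C_{m,d}\,\frac1{r^{2m}}\left(\Psi_r^{-2m/d}-1\right) \qquad\text{and}\qquad \lambda^{(m)}_\Omega\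 \ge\ c_{m,d}\,C_{m,d}\,\frac1{r^{2m}}\left(1-\Psi_r\right), $$ where $$ C_{m,d}:=\frac{(d+2m-2)(d+2m-4)\cdots d\cdot(2m-1)(2m-3)\cdots 1}{4^m},\qquad c_{m,d}:=\left(\frac{d+2m}{2m}\right)^{2m/d}\frac{d+2m}{d}. $$ In particular, for $m=1$, the bottom $\lambda^{(1)}_\Omega$ of the spectrum of the Dirichlet Laplacian satisfies $$ \lambda^{(1)}_\Omega\ \ge\ \frac d4\,\frac1{r^2}\left(\Psi_r^{-2/d}-1\right). $$ -/

import Mathlib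

open MeasureTheory Filter Topology
open scoped ENNReal ContDiff

noncomputable section

namespace Polyharmonic

/-! ### Unbounded operators on a Hilbert space -/

section Operators

variable {H : Type*} [NormedAddCommGroup H] [InnerProductSpace ℂ H]

/-- `z` lies in the resolvent set of the unbounded operator `A` if `A - z`, as a map from the
domain of `A` to `H`, has a bounded two-sided inverse defined on all of `H`. -/
def resolventSet (A : H →ₗ.[ℂ] H) : Set ℂ :=
  {z | ∃ R : H →L[ℂ] H,
    (∀ g : H, ∃ hg : R g ∈ A.domain, A ⟨R g, hg⟩ - z • R g = g) ∧
    ∀ u : A.domain, R (A u - z • (u : H)) = u}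

/-- The spectrum of an unbounded operator. -/
def spectrum (A : H →ₗ.[ℂ] H) : Set ℂ := (resolventSet A)ᶜ

/-- The infimum of the (real) spectrum, with the convention `inf ∅ = +∞`; the spectrum of a
selfadjoint operator is a subset of the real line, and it is empty only if the Hilbert space is
trivial. -/
def bottomOfSpectrum (A : H →ₗ.[ℂ] H) : EReal :=
  ⨅ μ ∈ {μ : ℝ | (μ : ℂ) ∈ spectrum A}, (μ : EReal)

end Operators

variable {d : ℕ}

/-- The complex Hilbert space `L²(Ω)`, `Ω ⊆ ℝ^d`, with respect to Lebesgue measure. -/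
abbrev L2 (Ω : Set (EuclideanSpace ℝ (Fin d))) : Type :=
  Lp ℂ 2 ((volume : Measure (EuclideanSpace ℝ (Fin d))).restrict Ω)

/-- The space `C_c^∞(Ω)` of complex-valued test functions. -/
def testFunctions (Ω : Set (EuclideanSpace ℝ (Fin d))) :
    Submodule ℂ (EuclideanSpace ℝ (Fin d) → ℂ) where
  carrier := {φ | ContDiff ℝ ∞ φ ∧ HasCompactSupport φ ∧ tsupport φ ⊆ Ω}
  zero_mem' := by
    refine ⟨contDiff_const, HasCompactSupport.zero, ?_⟩
    simp [tsupport]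
  add_mem' := by
    rintro φ ψ ⟨h1, h2, h3⟩ ⟨k1, k2, k3⟩
    exact ⟨h1.add k1, h2.add k2, (tsupport_add φ ψ).trans (Set.union_subset h3 k3)⟩
  smul_mem' := by
    rintro c φ ⟨h1, h2, h3⟩
    refine ⟨contDiff_const.smul h1, h2.smul_left (f := fun _ => c), ?_⟩
    exact (closure_mono (Function.support_const_smul_subset c φ)).trans h3

/-- The classical partial derivative `∂φ/∂x_i`. -/
def partialDeriv (i : Fin d) (φ : EuclideanSpace ℝ (Fin d) → ℂ)
    (x : EuclideanSpace ℝ (Fin d)) : ℂ :=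
  fderiv ℝ φ x (EuclideanSpace.single i 1)

theorem integrable_mul_of_test {Ω : Set (EuclideanSpace ℝ (Fin d))}
    {φ : EuclideanSpace ℝ (Fin d) → ℂ} (hφ : φ ∈ testFunctions Ω) (u : L2 Ω) :
    Integrable (fun x => φ x * u x) (volume.restrict Ω) :=
  MemLp.integrable_mul (hφ.1.continuous.memLp_of_hasCompactSupport hφ.2.1 (p := 2)) (Lp.memLp u)

theorem partialDeriv_mem_test {Ω : Set (EuclideanSpace ℝ (Fin d))}
    {φ : EuclideanSpace ℝ (Fin d) → ℂ} (hφ : φ ∈ testFunctions Ω) (i : Fin d) :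
    partialDeriv i φ ∈ testFunctions Ω := by
  obtain ⟨h1, h2, h3⟩ := hφ
  refine ⟨?_, h2.fderiv_apply ℝ _, ?_⟩
  · exact (h1.fderiv_right (m := ∞) (by simp)).clm_apply contDiff_const
  · exact (tsupport_fderiv_apply_subset ℝ _).trans h3

/-- The graph of the weak partial derivative in `L²(Ω)`: the pairs `(u, g)` with
`∫_Ω ∂ᵢφ u = - ∫_Ω φ g` for all `φ ∈ C_c^∞(Ω)`. -/
def weakPartialGraph (Ω : Set (EuclideanSpace ℝ (Fin d))) (i : Fin d) :
    Submodule ℂ (L2 Ω × L2 Ω) where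
  carrier := {p | ∀ φ ∈ testFunctions Ω,
    ∫ x in Ω, partialDeriv i φ x * p.1 x = -∫ x in Ω, φ x * p.2 x}
  zero_mem' := by
    intro φ _
    have h0 : ∀ ψ : EuclideanSpace ℝ (Fin d) → ℂ,
        ∫ x in Ω, ψ x * (0 : L2 Ω) x = 0 := by
      intro ψ
      refine integral_eq_zero_of_ae ?_
      filter_upwards [Lp.coeFn_zero ℂ 2 (volume.restrict Ω)] with x hx
      rw [hx, Pi.zero_apply, mul_zero]
    rw [Prod.fst_zero, Prod.snd_zero, h0, h0, neg_zero]
  add_mem' := by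
    rintro ⟨u, f⟩ ⟨v, g⟩ hu hv φ hφ
    have h0 : ∀ ψ ∈ testFunctions Ω, ∀ a b : L2 Ω,
        ∫ x in Ω, ψ x * (a + b : L2 Ω) x
          = (∫ x in Ω, ψ x * a x) + ∫ x in Ω, ψ x * b x := by
      intro ψ hψ a b
      rw [← integral_add (integrable_mul_of_test hψ a) (integrable_mul_of_test hψ b)]
      refine integral_congr_ae ?_
      filter_upwards [Lp.coeFn_add a b] with x hx
      rw [hx, Pi.add_apply, mul_add]
    have e1 := hu φ hφ
    have e2 := hv φ hφ
    simp only [Prod.mk_add_mk] at e1 e2 ⊢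
    rw [h0 _ (partialDeriv_mem_test hφ i), h0 _ hφ, e1, e2]
    ring
  smul_mem' := by
    rintro c ⟨u, f⟩ hu φ hφ
    have h0 : ∀ (ψ : EuclideanSpace ℝ (Fin d) → ℂ) (a : L2 Ω),
        ∫ x in Ω, ψ x * (c • a : L2 Ω) x = c * ∫ x in Ω, ψ x * a x := by
      intro ψ a
      rw [← integral_const_mul]
      refine integral_congr_ae ?_
      filter_upwards [Lp.coeFn_smul c a] with x hx
      simp only [hx, Pi.smul_apply, smul_eq_mul]
      ring
    have e1 := hu φ hφ
    simp only [Prod.smul_mk] at e1 ⊢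
    rw [h0, h0, e1]
    ring

/-- The weak partial derivative `∂ᵢ` as an unbounded operator in `L²(Ω)`; its domain consists of
all `u ∈ L²(Ω)` whose weak derivative `∂ᵢu` exists and belongs to `L²(Ω)`. -/
def weakPartial (Ω : Set (EuclideanSpace ℝ (Fin d))) (i : Fin d) : L2 Ω →ₗ.[ℂ] L2 Ω :=
  (weakPartialGraph Ω i).toLinearPMap

/-- The Sobolev space `H^m(Ω)`: all weak derivatives of order at most `m` exist and belong to
`L²(Ω)`. That is, `H^0(Ω) = L²(Ω)`, and `u ∈ H^{m+1}(Ω)` iff every `∂ᵢu` exists weakly and belongs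
to `H^m(Ω)`. -/
def sobolev (Ω : Set (EuclideanSpace ℝ (Fin d))) : ℕ → Submodule ℂ (L2 Ω)
  | 0 => ⊤
  | m + 1 =>
    { carrier := {u | ∀ i, ∃ hu : u ∈ (weakPartial Ω i).domain,
        weakPartial Ω i ⟨u, hu⟩ ∈ sobolev Ω m}
      zero_mem' := fun i => ⟨Submodule.zero_mem _, by
        have h : weakPartial Ω i ⟨0, Submodule.zero_mem _⟩ = 0 := (weakPartial Ω i).map_zero
        rw [h]
        exact Submodule.zero_mem (sobolev Ω m)⟩
      add_mem' := fun {u v} hu hv i => by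
        obtain ⟨h1, h2⟩ := hu i
        obtain ⟨k1, k2⟩ := hv i
        refine ⟨Submodule.add_mem _ h1 k1, ?_⟩
        have h := (weakPartial Ω i).map_add ⟨u, h1⟩ ⟨v, k1⟩
        exact h ▸ Submodule.add_mem _ h2 k2
      smul_mem' := fun c u hu i => by
        obtain ⟨h1, h2⟩ := hu i
        refine ⟨Submodule.smul_mem _ c h1, ?_⟩
        have h := (weakPartial Ω i).map_smul c ⟨u, h1⟩
        exact h ▸ Submodule.smul_mem _ c h2 }

/-- The weak partial derivative `∂ᵢ : H^{m+1}(Ω) → H^m(Ω)`. -/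
def sobolevPartial (Ω : Set (EuclideanSpace ℝ (Fin d))) (m : ℕ) (i : Fin d) :
    sobolev Ω (m + 1) →ₗ[ℂ] sobolev Ω m where
  toFun u := ⟨weakPartial Ω i ⟨u, (u.2 i).1⟩, (u.2 i).2⟩
  map_add' u v := Subtype.ext
    ((weakPartial Ω i).map_add ⟨u, (u.2 i).1⟩ ⟨v, (v.2 i).1⟩)
  map_smul' c u := Subtype.ext
    ((weakPartial Ω i).map_smul c ⟨u, (u.2 i).1⟩)

/-- `-Δ = -∑ᵢ ∂ᵢ∂ᵢ : H^{m+2}(Ω) → H^m(Ω)`. -/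
def negLaplacian (Ω : Set (EuclideanSpace ℝ (Fin d))) (m : ℕ) :
    sobolev Ω (m + 2) →ₗ[ℂ] sobolev Ω m :=
  -∑ i, (sobolevPartial Ω m i) ∘ₗ (sobolevPartial Ω (m + 1) i)

/-- The square of the norm of `H^m(Ω)`, i.e. the sum of `‖∂_{i₁}⋯∂_{iₖ}u‖²` over all
`0 ≤ k ≤ m` and all `i₁, …, iₖ`. -/
def sobolevNormSq (Ω : Set (EuclideanSpace ℝ (Fin d))) : (m : ℕ) → sobolev Ω m → ℝ
  | 0, u => ‖(u : L2 Ω)‖ ^ 2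
  | m + 1, u => ‖(u : L2 Ω)‖ ^ 2 + ∑ i, sobolevNormSq Ω m (sobolevPartial Ω m i u)

theorem norm_add_sq_le_two {E : Type*} [SeminormedAddCommGroup E] (a b : E) :
    ‖a + b‖ ^ 2 ≤ 2 * ‖a‖ ^ 2 + 2 * ‖b‖ ^ 2 := by
  have h := norm_add_le a b
  have h0 := norm_nonneg (a + b)
  nlinarith [sq_nonneg (‖a‖ - ‖b‖)]

theorem sobolevNormSq_add_le (Ω : Set (EuclideanSpace ℝ (Fin d))) (m : ℕ)
    (u v : sobolev Ω m) :
    sobolevNormSq Ω m (u + v) ≤ 2 * sobolevNormSq Ω m u + 2 * sobolevNormSq Ω m v := by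
  induction m with
  | zero => exact norm_add_sq_le_two (u : L2 Ω) v
  | succ m ih =>
    simp only [sobolevNormSq, map_add]
    have h1 := norm_add_sq_le_two (u : L2 Ω) v
    have h2 := Finset.sum_le_sum (s := Finset.univ) fun i (_ : i ∈ Finset.univ) =>
      ih (sobolevPartial Ω m i u) (sobolevPartial Ω m i v)
    rw [Finset.sum_add_distrib, ← Finset.mul_sum, ← Finset.mul_sum] at h2
    rw [Submodule.coe_add]
    linarith

theorem sobolevNormSq_smul (Ω : Set (EuclideanSpace ℝ (Fin d))) (m : ℕ) (c : ℂ)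
    (u : sobolev Ω m) :
    sobolevNormSq Ω m (c • u) = ‖c‖ ^ 2 * sobolevNormSq Ω m u := by
  induction m with
  | zero => simp only [sobolevNormSq, Submodule.coe_smul, norm_smul, mul_pow]
  | succ m ih =>
    simp only [sobolevNormSq, map_smul, ih, Submodule.coe_smul, norm_smul, mul_pow,
      ← Finset.mul_sum, mul_add]

/-- `H^m_0(Ω)`: the closure of `C_c^∞(Ω)` in `H^m(Ω)`. -/
def sobolevZero (Ω : Set (EuclideanSpace ℝ (Fin d))) (m : ℕ) : Submodule ℂ (sobolev Ω m) where
  carrier := {u | ∀ ε > 0, ∃ w : sobolev Ω m,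
    (∃ φ ∈ testFunctions Ω, (w : L2 Ω) =ᵐ[volume.restrict Ω] φ) ∧
      sobolevNormSq Ω m (u - w) < ε}
  zero_mem' := by
    intro ε hε
    refine ⟨0, ⟨0, Submodule.zero_mem _, Lp.coeFn_zero ℂ 2 (volume.restrict Ω)⟩, ?_⟩
    have h := sobolevNormSq_smul Ω m 0 0
    rw [smul_zero, norm_zero, zero_pow two_ne_zero, zero_mul] at h
    rw [sub_zero, h]
    exact hε
  add_mem' := by
    intro u v hu hv ε hε
    obtain ⟨w, ⟨φ, hφ, hw⟩, h1⟩ := hu (ε / 4) (by positivity)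
    obtain ⟨w', ⟨ψ, hψ, hw'⟩, h2⟩ := hv (ε / 4) (by positivity)
    refine ⟨w + w', ⟨φ + ψ, Submodule.add_mem _ hφ hψ, ?_⟩, ?_⟩
    · exact (Lp.coeFn_add (w : L2 Ω) w').trans (hw.add hw')
    · have h := sobolevNormSq_add_le Ω m (u - w) (v - w')
      rw [add_sub_add_comm]
      linarith
  smul_mem' := by
    intro c u hu ε hε
    obtain ⟨w, ⟨φ, hφ, hw⟩, h1⟩ := hu (ε / (‖c‖ ^ 2 + 1)) (by positivity)
    refine ⟨c • w, ⟨c • φ, Submodule.smul_mem _ c hφ, ?_⟩, ?_⟩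
    · exact (Lp.coeFn_smul c (w : L2 Ω)).trans (hw.const_smul c)
    · rw [← smul_sub, sobolevNormSq_smul]
      rw [lt_div_iff₀ (by positivity)] at h1
      by_cases h0 : 0 ≤ sobolevNormSq Ω m (u - w)
      · nlinarith
      · nlinarith [sq_nonneg ‖c‖, not_le.mp h0]

/-- The sesquilinear form (antilinear in the first argument) of the polyharmonic operator on
`H^m(Ω)`. Unfolding the recursion, it is `∫_Ω conj((-Δ)^{m/2} u) (-Δ)^{m/2} v` for even `m`, and
`∑ᵢ ∫_Ω conj(∂ᵢ(-Δ)^{(m-1)/2} u) ∂ᵢ(-Δ)^{(m-1)/2} v` for odd `m`. -/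
def form (Ω : Set (EuclideanSpace ℝ (Fin d))) : (m : ℕ) → sobolev Ω m → sobolev Ω m → ℂ
  | 0, u, v => inner ℂ (u : L2 Ω) (v : L2 Ω)
  | 1, u, v => ∑ i, inner ℂ (sobolevPartial Ω 0 i u : L2 Ω) (sobolevPartial Ω 0 i v : L2 Ω)
  | m + 2, u, v => form Ω m (negLaplacian Ω m u) (negLaplacian Ω m v)

theorem form_add_right (Ω : Set (EuclideanSpace ℝ (Fin d))) :
    ∀ (m : ℕ) (u v w : sobolev Ω m), form Ω m u (v + w) = form Ω m u v + form Ω m u w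
  | 0, u, v, w => by simp only [form, Submodule.coe_add, inner_add_right]
  | 1, u, v, w => by
    simp only [form, map_add, Submodule.coe_add, inner_add_right, Finset.sum_add_distrib]
  | m + 2, u, v, w => by simp only [form, map_add, form_add_right Ω m]

theorem form_smul_right (Ω : Set (EuclideanSpace ℝ (Fin d))) (c : ℂ) :
    ∀ (m : ℕ) (u v : sobolev Ω m), form Ω m u (c • v) = c * form Ω m u v
  | 0, u, v => by simp only [form, Submodule.coe_smul, inner_smul_right]
  | 1, u, v => by
    simp only [form, map_smul, Submodule.coe_smul, inner_smul_right, Finset.mul_sum]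
  | m + 2, u, v => by simp only [form, map_smul, form_smul_right Ω c m]

/-- The graph of the operator in `L²(Ω)` generated by the quadratic form with form domain
`H^m_0(Ω)`: the pairs `(u, f)` with `u ∈ H^m_0(Ω)`, `f ∈ L²(Ω)` and `h[v, u] = ⟨v, f⟩` for all
`v ∈ H^m_0(Ω)`. -/
def dirichletPolyharmonicGraph (Ω : Set (EuclideanSpace ℝ (Fin d))) (m : ℕ) :
    Submodule ℂ (L2 Ω × L2 Ω) where
  carrier := {p | ∃ u ∈ sobolevZero Ω m, (u : L2 Ω) = p.1 ∧
    ∀ v ∈ sobolevZero Ω m, form Ω m v u = inner ℂ (v : L2 Ω) p.2}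
  zero_mem' := by
    refine ⟨0, Submodule.zero_mem _, rfl, fun v _ => ?_⟩
    have h := form_smul_right Ω 0 m v 0
    simpa using h
  add_mem' := by
    rintro ⟨_, f⟩ ⟨_, g⟩ ⟨u, hu, rfl, h1⟩ ⟨w, hw, rfl, h2⟩
    refine ⟨u + w, Submodule.add_mem _ hu hw, rfl, fun v hv => ?_⟩
    simp only [Prod.mk_add_mk] at h1 h2 ⊢
    rw [form_add_right, h1 v hv, h2 v hv, inner_add_right]
  smul_mem' := by
    rintro c ⟨_, f⟩ ⟨u, hu, rfl, h1⟩
    refine ⟨c • u, Submodule.smul_mem _ c hu, rfl, fun v hv => ?_⟩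
    simp only [Prod.smul_mk] at h1 ⊢
    rw [form_smul_right, h1 v hv, inner_smul_right]

/-- The Dirichlet realization of `(-Δ)^m` in `L²(Ω)`. For `m = 1` this is the Dirichlet
Laplacian. -/
def dirichletPolyharmonic (Ω : Set (EuclideanSpace ℝ (Fin d))) (m : ℕ) : L2 Ω →ₗ.[ℂ] L2 Ω :=
  (dirichletPolyharmonicGraph Ω m).toLinearPMap

/-- `λ_Ω^{(m)}`: the infimum of the spectrum of the Dirichlet realization of `(-Δ)^m`. -/
def lambda (Ω : Set (EuclideanSpace ℝ (Fin d))) (m : ℕ) : EReal :=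
  bottomOfSpectrum (dirichletPolyharmonic Ω m)

/-- `Ψ_r = sup_{x ∈ Ω} |Ω ∩ B_r(x)| / |B_r(x)|`. -/
def Psi (Ω : Set (EuclideanSpace ℝ (Fin d))) (r : ℝ) : ℝ≥0∞ :=
  ⨆ x ∈ Ω, volume (Ω ∩ Metric.ball x r) / volume (Metric.ball x r)

/-- `C_{m,d} = (d+2m-2)(d+2m-4)⋯d · (2m-1)(2m-3)⋯1 / 4^m`. -/
def bigC (m d : ℕ) : ℝ :=
  (∏ j ∈ Finset.range m, ((d : ℝ) + 2 * j)) * (∏ j ∈ Finset.range m, (2 * (j : ℝ) + 1)) / 4 ^ m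

/-- `c_{m,d} = ((d+2m)/(2m))^{2m/d} · (d+2m)/d`. -/
def smallC (m d : ℕ) : ℝ :=
  (((d : ℝ) + 2 * m) / (2 * m)) ^ (2 * (m : ℝ) / d) * (((d : ℝ) + 2 * m) / d)

end Polyharmonic

end

/-!
The form of `(-Δ)^m` is an average of one-dimensional forms: since the mean of `(θ·ξ)^{2m}` over the
unit sphere is a constant multiple of `|ξ|^{2m}` (`prod_mul_integral_sphere_inner_pow`), Plancherel's
theorem shows that `h[φ]` is a multiple of the spherical mean of `∫ |∂_θ^m φ|²`
(`prod_mul_integral_directional`). For a fixed direction `θ`, let `w_θ(x)` be the reciprocal of the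
distance from `x` to the complement of `Ω` along the ray `x + t θ`, `t > 0`. On `Ω` it solves
`∂_θ w = w²`, and this yields Birman's inequality `∫ |∂_θ^m φ|² ≥ ((2m-1)!!/2^m)² ∫ |φ|² w_θ^{2m}`
(`birman`), directly in `ℝ^d` and without decomposing lines into intervals. The distance in the
forward direction suffices, because directions are averaged over the whole sphere.

For fixed `x ∈ Ω` it remains to bound the spherical mean of `(r w_θ(x))^{2m}` from below. In polar
coordinates the part of `Ω ∩ B_r(x)` visible from `x` has relative volume equal to the mean of
`τ = (max 1 (r w_θ))^{-d}`, so this mean is at most `Ψ_r` (`integral_visible_le`). Both bounds of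
the theorem follow from linear lower bounds of `(r w)^{2m}` in terms of `τ`, which are tangent lines
of the convex function `τ ↦ τ^{-2m/d}`: at `τ = Ψ_r` for the first bound (this is Jensen's
inequality), and at the point whose tangent vanishes at `τ = 1` for the second.

The passage from test functions to the spectrum (`le_lambda`) uses that the form controls the
Sobolev norm on `H^m_0(Ω)`, again by Plancherel, and that `H^m(Ω)` is complete. For real `μ` below
the lower bound of the form, `h[u, v] - μ ⟨u, v⟩` is then the inner product of a Hilbert space, and
representing functionals in it gives the resolvent.
-/

/-! ### An abstract Lax–Milgram argument -/

/-- Let `V` be complete for the inner product `c` and let `T : V → H` be bounded. Then the map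
`R = T T*` on `H` is bounded, and `T* g` represents the functional `w ↦ ⟨T w, g⟩` on `V`. The
space `V` may carry other topologies, so completeness is stated with sequences and only the vector
space structure of `V` is used. -/
theorem exists_clm_of_core_complete {H V : Type*} [NormedAddCommGroup H] [InnerProductSpace ℂ H]
    [CompleteSpace H] [AddCommGroup V] [Module ℂ V] (c : InnerProductSpace.Core ℂ V)
    (T : V →ₗ[ℂ] H) (C : ℝ) (hT : ∀ v, ‖T v‖ ^ 2 ≤ C * (c.inner v v).re)
    (hc : ∀ u : ℕ → V,
      (∀ ε > 0, ∃ N, ∀ a ≥ N, ∀ b ≥ N, (c.inner (u a - u b) (u a - u b)).re < ε) →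
      ∃ v, Tendsto (fun n => (c.inner (u n - v) (u n - v)).re) atTop (𝓝 0)) :
    ∃ R : H →L[ℂ] H, ∀ g, ∃ v, R g = T v ∧ ∀ w, c.inner w v = inner ℂ (T w) g := by
  let _ : NormedAddCommGroup V := c.toNormedAddCommGroup
  let _ : InnerProductSpace ℂ V := InnerProductSpace.ofCore c.toCore
  have hn : ∀ v : V, (c.inner v v).re = ‖v‖ ^ 2 := fun v =>
    (norm_sq_eq_re_inner (𝕜 := ℂ) v).symm
  have : CompleteSpace V := by
    refine Metric.complete_of_cauchySeq_tendsto fun u hu => ?_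
    obtain ⟨v, hv⟩ := hc u fun ε hε => by
      obtain ⟨N, hN⟩ := Metric.cauchySeq_iff.1 hu (√ε) (Real.sqrt_pos.2 hε)
      refine ⟨N, fun a ha b hb => ?_⟩
      have h := hN a ha b hb
      rw [dist_eq_norm] at h
      rw [hn]
      exact (Real.lt_sqrt (norm_nonneg _)).1 h
    refine ⟨v, tendsto_iff_norm_sub_tendsto_zero.2 ?_⟩
    simp only [hn] at hv
    simpa using hv.sqrt
  have hC : ∀ v, ‖T v‖ ≤ √|C| * ‖v‖ := fun v => by
    refine abs_le_of_sq_le_sq' ?_ (by positivity) |>.2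
    rw [mul_pow, Real.sq_sqrt (abs_nonneg C)]
    have h := hT v
    rw [hn] at h
    exact h.trans (mul_le_mul_of_nonneg_right (le_abs_self C) (by positivity))
  let T' : V →L[ℂ] H := T.mkContinuous _ hC
  refine ⟨T' ∘L ContinuousLinearMap.adjoint T', fun g => ⟨ContinuousLinearMap.adjoint T' g, rfl,
    fun w => ?_⟩⟩
  exact ContinuousLinearMap.adjoint_inner_right T' w g

noncomputable section

namespace Polyharmonic

variable {d : ℕ} {Ω : Set (EuclideanSpace ℝ (Fin d))}

/-! ### Test functions as elements of `L²(Ω)` -/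

/-- The derivative of a test function in the direction `v`. -/
def testDeriv (v : EuclideanSpace ℝ (Fin d)) (φ : testFunctions Ω) : testFunctions Ω :=
  ⟨fun x => fderiv ℝ φ.1 x v,
    (φ.2.1.fderiv_right (m := ∞) (by simp)).clm_apply contDiff_const,
    φ.2.2.1.fderiv_apply ℝ v, (tsupport_fderiv_apply_subset ℝ v).trans φ.2.2.2⟩

/-- The partial derivative of a test function. -/
abbrev testPartial (i : Fin d) (φ : testFunctions Ω) : testFunctions Ω :=
  testDeriv (EuclideanSpace.single i 1) φ

/-- The complex conjugate of a test function. -/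
def testConj (φ : testFunctions Ω) : testFunctions Ω :=
  ⟨fun x => starRingEnd ℂ (φ.1 x), Complex.conjCLE.contDiff.comp φ.2.1,
    φ.2.2.1.comp_left (g := starRingEnd ℂ) (map_zero _),
    (closure_mono (Function.support_comp_subset (map_zero (starRingEnd ℂ)) φ.1)).trans φ.2.2.2⟩

theorem memLp_testFunctions (φ : testFunctions Ω) : MemLp φ.1 2 (volume.restrict Ω) :=
  φ.2.1.continuous.memLp_of_hasCompactSupport φ.2.2.1

/-- The class of a test function in `L²(Ω)`. -/
def testL2 : testFunctions Ω →ₗ[ℂ] L2 Ω where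
  toFun φ := (memLp_testFunctions φ).toLp φ.1
  map_add' _ _ := rfl
  map_smul' _ _ := rfl

theorem coeFn_testL2 (φ : testFunctions Ω) : testL2 φ =ᵐ[volume.restrict Ω] φ.1 :=
  MemLp.coeFn_toLp (memLp_testFunctions φ)

theorem testFunctions_differentiable (φ : testFunctions Ω) : Differentiable ℝ φ.1 :=
  φ.2.1.differentiable (by simp)

theorem testConj_testPartial (i : Fin d) (φ : testFunctions Ω) :
    testConj (testPartial i φ) = testPartial i (testConj φ) := by
  ext x
  have h := (Complex.conjCLE.toContinuousLinearMap.hasFDerivAt.comp x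
    (testFunctions_differentiable φ x).hasFDerivAt).fderiv
  change starRingEnd ℂ (fderiv ℝ φ.1 x _) =
    fderiv ℝ ((Complex.conjCLE : ℂ →L[ℝ] ℂ) ∘ φ.1) x _
  rw [h]
  rfl

theorem testConj_testConj (φ : testFunctions Ω) : testConj (testConj φ) = φ := by
  ext x
  simp [testConj]

theorem inner_testL2 (φ : testFunctions Ω) (u : L2 Ω) :
    inner ℂ (testL2 (testConj φ)) u = ∫ x in Ω, φ.1 x * u x := by
  rw [L2.inner_def]
  refine integral_congr_ae ?_
  filter_upwards [coeFn_testL2 (testConj φ)] with x hx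
  rw [hx, RCLike.inner_apply, testConj]
  simp [mul_comm]

theorem mem_weakPartialGraph_iff {i : Fin d} {u g : L2 Ω} :
    (u, g) ∈ weakPartialGraph Ω i ↔
      ∀ φ : testFunctions Ω, inner ℂ (testL2 (testPartial i φ)) u = -inner ℂ (testL2 φ) g := by
  constructor
  · intro h φ
    have h1 := h _ (testConj φ).2
    rw [← inner_testL2, testConj_testConj] at h1
    rw [← h1, ← testConj_testConj (testPartial i φ), inner_testL2, testConj_testPartial]
    rfl
  · intro h φ hφ
    have h1 := h (testConj ⟨φ, hφ⟩)
    rw [← testConj_testPartial, inner_testL2, inner_testL2] at h1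
    exact h1

/-- The fundamental lemma of the calculus of variations: test functions are dense in `L²(Ω)`. -/
theorem eq_zero_of_inner_testL2 (hΩ : IsOpen Ω) {g : L2 Ω}
    (h : ∀ φ : testFunctions Ω, inner ℂ (testL2 φ) g = 0) : g = 0 := by
  have hloc : LocallyIntegrableOn (g : EuclideanSpace ℝ (Fin d) → ℂ) Ω := by
    rw [locallyIntegrableOn_iff hΩ.isLocallyClosed]
    intro k hk hkc
    have : IsFiniteMeasure ((volume.restrict Ω).restrict k) :=
      ⟨by
        rw [Measure.restrict_apply_univ]
        exact (Measure.restrict_apply_le _ _).trans_lt hkc.measure_lt_top⟩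
    have h2 := ((Lp.memLp g).restrict k).integrable (by norm_num)
    rwa [Measure.restrict_restrict hkc.measurableSet, Set.inter_eq_left.2 hk] at h2
  have h0 := hΩ.ae_eq_zero_of_integral_contDiff_smul_eq_zero hloc fun ψ h1 h2 h3 => by
    let φ : testFunctions Ω := ⟨fun x => (ψ x : ℂ), Complex.ofRealCLM.contDiff.comp h1,
      h2.comp_left (g := Complex.ofReal) rfl,
      (closure_mono (Function.support_comp_subset (g := Complex.ofReal) rfl ψ)).trans h3⟩
    have h4 := h (testConj φ)
    rw [inner_testL2] at h4
    rw [← h4, setIntegral_eq_integral_of_forall_compl_eq_zero]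
    · rfl
    · intro x hx
      have : ψ x = 0 := by
        by_contra h5
        exact hx (h3 (subset_tsupport ψ h5))
      simp [φ, this]
  refine Lp.ext ?_
  have h5 := (ae_restrict_iff' hΩ.measurableSet).2 h0
  exact Filter.EventuallyEq.trans h5 (Lp.coeFn_zero ℂ 2 _).symm

theorem snd_eq_zero_of_mem_weakPartialGraph (hΩ : IsOpen Ω) (i : Fin d) :
    ∀ p ∈ weakPartialGraph Ω i, p.1 = 0 → p.2 = 0 := by
  rintro ⟨u, g⟩ h (rfl : u = 0)
  refine eq_zero_of_inner_testL2 hΩ fun φ => ?_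
  have h1 := mem_weakPartialGraph_iff.1 h φ
  rw [inner_zero_right] at h1
  exact neg_eq_zero.1 h1.symm

theorem mem_weakPartialGraph_weakPartial (hΩ : IsOpen Ω) (i : Fin d)
    (u : (weakPartial Ω i).domain) : ((u : L2 Ω), weakPartial Ω i u) ∈ weakPartialGraph Ω i :=
  Submodule.mem_graph_toLinearPMap (snd_eq_zero_of_mem_weakPartialGraph hΩ i) u

theorem weakPartialGraph_unique (hΩ : IsOpen Ω) {i : Fin d} {u g g' : L2 Ω}
    (h : (u, g) ∈ weakPartialGraph Ω i) (h' : (u, g') ∈ weakPartialGraph Ω i) : g = g' := by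
  have h1 := snd_eq_zero_of_mem_weakPartialGraph hΩ i _ (Submodule.sub_mem _ h h') (sub_self u)
  exact sub_eq_zero.1 h1

theorem sobolevPartial_mem_graph (hΩ : IsOpen Ω) {m : ℕ} (i : Fin d) (u : sobolev Ω (m + 1)) :
    ((u : L2 Ω), (sobolevPartial Ω m i u : L2 Ω)) ∈ weakPartialGraph Ω i :=
  mem_weakPartialGraph_weakPartial hΩ i ⟨u, (u.2 i).1⟩

/-- Membership in `H^{m+1}(Ω)` in terms of the graphs of the weak derivatives. -/
theorem mem_sobolev_succ (hΩ : IsOpen Ω) {m : ℕ} {u : L2 Ω} (g : Fin d → sobolev Ω m)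
    (h : ∀ i, (u, (g i : L2 Ω)) ∈ weakPartialGraph Ω i) :
    ∃ v : sobolev Ω (m + 1), (v : L2 Ω) = u ∧ ∀ i, sobolevPartial Ω m i v = g i := by
  have hd : ∀ i, u ∈ (weakPartial Ω i).domain := fun i => ⟨_, h i, rfl⟩
  have he : ∀ i, weakPartial Ω i ⟨u, hd i⟩ = g i := fun i =>
    weakPartialGraph_unique hΩ (mem_weakPartialGraph_weakPartial hΩ i ⟨u, hd i⟩) (h i)
  exact ⟨⟨u, fun i => ⟨hd i, he i ▸ (g i).2⟩⟩, rfl, fun i => Subtype.ext (he i)⟩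

/-! ### The Sobolev norm and the form -/

theorem sobolevNormSq_nonneg : ∀ (m : ℕ) (u : sobolev Ω m), 0 ≤ sobolevNormSq Ω m u
  | 0, _ => sq_nonneg _
  | m + 1, _ => add_nonneg (sq_nonneg _) (Finset.sum_nonneg fun _ _ => sobolevNormSq_nonneg m _)

theorem sobolevNormSq_zero (m : ℕ) : sobolevNormSq Ω m 0 = 0 := by
  have h := sobolevNormSq_smul Ω m 0 0
  simpa using h

theorem sobolevNormSq_neg (m : ℕ) (u : sobolev Ω m) :
    sobolevNormSq Ω m (-u) = sobolevNormSq Ω m u := by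
  have h := sobolevNormSq_smul Ω m (-1) u
  simpa using h

theorem norm_sq_le_sobolevNormSq :
    ∀ (m : ℕ) (u : sobolev Ω m), ‖(u : L2 Ω)‖ ^ 2 ≤ sobolevNormSq Ω m u
  | 0, _ => le_rfl
  | m + 1, _ => le_add_of_nonneg_right (Finset.sum_nonneg fun _ _ => sobolevNormSq_nonneg m _)

theorem sobolevNormSq_partial_le (m : ℕ) (i : Fin d) (u : sobolev Ω (m + 1)) :
    sobolevNormSq Ω m (sobolevPartial Ω m i u) ≤ sobolevNormSq Ω (m + 1) u :=
  (Finset.single_le_sum (f := fun i => sobolevNormSq Ω m (sobolevPartial Ω m i u))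
    (fun _ _ => sobolevNormSq_nonneg m _) (Finset.mem_univ i)).trans
    (le_add_of_nonneg_left (sq_nonneg _))

/-- Convergence in `H^m(Ω)`, expressed through the square of the norm. -/
def SobolevTendsto (m : ℕ) (w : ℕ → sobolev Ω m) (u : sobolev Ω m) : Prop :=
  Tendsto (fun n => sobolevNormSq Ω m (w n - u)) atTop (𝓝 0)

namespace SobolevTendsto

variable {m : ℕ} {w z : ℕ → sobolev Ω m} {u v : sobolev Ω m}

theorem add (hw : SobolevTendsto m w u) (hz : SobolevTendsto m z v) :
    SobolevTendsto m (fun n => w n + z n) (u + v) := by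
  refine squeeze_zero (fun n => sobolevNormSq_nonneg m _) (fun n => ?_)
    (g := fun n => 2 * sobolevNormSq Ω m (w n - u) + 2 * sobolevNormSq Ω m (z n - v)) ?_
  · rw [add_sub_add_comm]
    exact sobolevNormSq_add_le Ω m _ _
  · simpa using (Tendsto.const_mul 2 hw).add (Tendsto.const_mul 2 hz)

theorem neg (hw : SobolevTendsto m w u) : SobolevTendsto m (fun n => -w n) (-u) := by
  refine Tendsto.congr (fun n => ?_) hw
  rw [← sobolevNormSq_neg, neg_sub, neg_sub_neg]

theorem sum {ι : Type*} (s : Finset ι) {w : ι → ℕ → sobolev Ω m} {u : ι → sobolev Ω m}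
    (h : ∀ i, SobolevTendsto m (w i) (u i)) :
    SobolevTendsto m (fun n => ∑ i ∈ s, w i n) (∑ i ∈ s, u i) := by
  classical
  induction s using Finset.induction_on with
  | empty => simp [SobolevTendsto, sobolevNormSq_zero]
  | insert i s hi ih =>
    simp only [Finset.sum_insert hi]
    exact (h i).add ih

theorem coe (hw : SobolevTendsto m w u) :
    Tendsto (fun n => (w n : L2 Ω)) atTop (𝓝 (u : L2 Ω)) := by
  rw [tendsto_iff_norm_sub_tendsto_zero]
  have h := squeeze_zero (fun n => sq_nonneg _)
    (fun n => norm_sq_le_sobolevNormSq m (w n - u)) hw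
  simpa using h.sqrt

theorem weakDeriv {w : ℕ → sobolev Ω (m + 1)} {u : sobolev Ω (m + 1)}
    (hw : SobolevTendsto (m + 1) w u) (i : Fin d) :
    SobolevTendsto m (fun n => sobolevPartial Ω m i (w n)) (sobolevPartial Ω m i u) := by
  refine squeeze_zero (fun n => sobolevNormSq_nonneg m _) (fun n => ?_) hw
  rw [← map_sub]
  exact sobolevNormSq_partial_le m i _

theorem negLaplacian {w : ℕ → sobolev Ω (m + 2)} {u : sobolev Ω (m + 2)}
    (hw : SobolevTendsto (m + 2) w u) :
    SobolevTendsto m (fun n => negLaplacian Ω m (w n)) (negLaplacian Ω m u) := by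
  simp only [Polyharmonic.negLaplacian, LinearMap.neg_apply, LinearMap.sum_apply,
    LinearMap.comp_apply]
  exact (sum _ fun i => (hw.weakDeriv i).weakDeriv i).neg

end SobolevTendsto

theorem SobolevTendsto.tendsto_sobolevNormSq :
    ∀ {m : ℕ} {w : ℕ → sobolev Ω m} {u : sobolev Ω m}, SobolevTendsto m w u →
      Tendsto (fun n => sobolevNormSq Ω m (w n)) atTop (𝓝 (sobolevNormSq Ω m u))
  | 0, _, _, h => h.coe.norm.pow 2
  | _ + 1, _, _, h => (h.coe.norm.pow 2).add
      (tendsto_finsetSum _ fun i _ => (h.weakDeriv i).tendsto_sobolevNormSq)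

theorem SobolevTendsto.tendsto_form :
    ∀ {m : ℕ} {w z : ℕ → sobolev Ω m} {u v : sobolev Ω m}, SobolevTendsto m w u →
      SobolevTendsto m z v →
      Tendsto (fun n => form Ω m (w n) (z n)) atTop (𝓝 (form Ω m u v))
  | 0, _, _, _, _, h, k => h.coe.inner k.coe
  | 1, _, _, _, _, h, k => tendsto_finsetSum _ fun i _ => (h.weakDeriv i).coe.inner (k.weakDeriv i).coe
  | _ + 2, _, _, _, _, h, k => by
    have := SobolevTendsto.tendsto_form h.negLaplacian k.negLaplacian
    exact this

/-- `H^m(Ω)` is complete. -/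
theorem sobolev_complete (hΩ : IsOpen Ω) : ∀ (m : ℕ) (u : ℕ → sobolev Ω m),
    (∀ ε > 0, ∃ N, ∀ a ≥ N, ∀ b ≥ N, sobolevNormSq Ω m (u a - u b) < ε) →
    ∃ v, SobolevTendsto m u v := by
  have key : ∀ (m : ℕ) (u : ℕ → sobolev Ω m),
      (∀ ε > 0, ∃ N, ∀ a ≥ N, ∀ b ≥ N, sobolevNormSq Ω m (u a - u b) < ε) →
      ∃ v : L2 Ω, Tendsto (fun n => (u n : L2 Ω)) atTop (𝓝 v) := by
    intro m u hu
    refine cauchySeq_tendsto_of_complete (Metric.cauchySeq_iff.2 fun ε hε => ?_)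
    obtain ⟨N, hN⟩ := hu (ε ^ 2) (by positivity)
    refine ⟨N, fun a ha b hb => ?_⟩
    rw [dist_eq_norm]
    have h := norm_sq_le_sobolevNormSq m (u a - u b)
    rw [Submodule.coe_sub] at h
    exact lt_of_pow_lt_pow_left₀ 2 hε.le (h.trans_lt (hN a ha b hb))
  intro m
  induction m with
  | zero =>
    intro u hu
    obtain ⟨v, hv⟩ := key 0 u hu
    refine ⟨⟨v, Submodule.mem_top⟩, ?_⟩
    simpa [SobolevTendsto, sobolevNormSq] using (tendsto_iff_norm_sub_tendsto_zero.1 hv).pow 2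
  | succ m ih =>
    intro u hu
    obtain ⟨v, hv⟩ := key _ u hu
    have hp : ∀ i, ∃ g, SobolevTendsto m (fun n => sobolevPartial Ω m i (u n)) g := fun i =>
      ih _ fun ε hε => by
        obtain ⟨N, hN⟩ := hu ε hε
        refine ⟨N, fun a ha b hb => ?_⟩
        rw [← map_sub]
        exact (sobolevNormSq_partial_le m i _).trans_lt (hN a ha b hb)
    choose g hg using hp
    obtain ⟨w, rfl, hw⟩ := mem_sobolev_succ hΩ (u := v) g fun i =>
      mem_weakPartialGraph_iff.2 fun φ => by
        have h1 := (tendsto_const_nhds (x := testL2 (testPartial i φ))).inner (𝕜 := ℂ) hv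
        have h2 := ((tendsto_const_nhds (x := testL2 φ)).inner (𝕜 := ℂ) (hg i).coe).neg
        refine tendsto_nhds_unique h1 (h2.congr fun n => ?_)
        exact (mem_weakPartialGraph_iff.1 (sobolevPartial_mem_graph hΩ i (u n)) φ).symm
    refine ⟨w, ?_⟩
    have h1 := (tendsto_iff_norm_sub_tendsto_zero.1 hv).pow 2
    have h2 := h1.add (tendsto_finsetSum Finset.univ fun i _ => hg i)
    simp only [ne_eq, OfNat.ofNat_ne_zero, not_false_eq_true, zero_pow, Finset.sum_const_zero,
      add_zero] at h2
    refine h2.congr fun n => ?_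
    simp only [Polyharmonic.sobolevNormSq, map_sub, hw, Submodule.coe_sub]

theorem mem_sobolevZero_iff {m : ℕ} {u : sobolev Ω m} : u ∈ sobolevZero Ω m ↔
    ∃ w : ℕ → sobolev Ω m, (∀ n, ∃ φ : testFunctions Ω, (w n : L2 Ω) = testL2 φ) ∧
      SobolevTendsto m w u := by
  constructor
  · intro h
    choose w hw hu using fun n : ℕ => h (1 / (n + 1)) Nat.one_div_pos_of_nat
    refine ⟨w, fun n => ?_, ?_⟩
    · obtain ⟨φ, hφ, he⟩ := hw n
      exact ⟨⟨φ, hφ⟩, Lp.ext (he.trans (coeFn_testL2 ⟨φ, hφ⟩).symm)⟩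
    · refine squeeze_zero (fun n => sobolevNormSq_nonneg m _) (fun n => ?_)
        tendsto_one_div_add_atTop_nhds_zero_nat
      rw [← neg_sub, sobolevNormSq_neg]
      exact (hu n).le
  · rintro ⟨w, hw, hu⟩ ε hε
    obtain ⟨n, hn⟩ := ((tendsto_order.1 hu).2 ε hε).exists
    obtain ⟨φ, hφ⟩ := hw n
    refine ⟨w n, ⟨φ, φ.2, hφ ▸ coeFn_testL2 φ⟩, ?_⟩
    rwa [← neg_sub, sobolevNormSq_neg]

theorem sobolevZero_closed {m : ℕ} {w : ℕ → sobolev Ω m} {u : sobolev Ω m}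
    (hw : ∀ n, w n ∈ sobolevZero Ω m) (hu : SobolevTendsto m w u) : u ∈ sobolevZero Ω m := by
  intro ε hε
  obtain ⟨n, hn⟩ := ((tendsto_order.1 hu).2 (ε / 4) (by positivity)).exists
  obtain ⟨z, hz, h⟩ := hw n (ε / 4) (by positivity)
  refine ⟨z, hz, ?_⟩
  have h1 := sobolevNormSq_add_le Ω m (u - w n) (w n - z)
  rw [sub_add_sub_cancel, ← neg_sub (w n) u, sobolevNormSq_neg] at h1
  linarith

theorem form_conj_symm : ∀ (m : ℕ) (u v : sobolev Ω m),
    starRingEnd ℂ (form Ω m v u) = form Ω m u v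
  | 0, u, v => inner_conj_symm _ _
  | 1, u, v => by simp only [form, map_sum, inner_conj_symm]
  | m + 2, u, v => form_conj_symm m _ _

theorem re_form_self_nonneg : ∀ (m : ℕ) (u : sobolev Ω m), 0 ≤ (form Ω m u u).re
  | 0, u => inner_self_nonneg (𝕜 := ℂ) (x := (u : L2 Ω))
  | 1, u => by
    simp only [form, Complex.re_sum]
    exact Finset.sum_nonneg fun i _ => inner_self_nonneg (𝕜 := ℂ)
  | m + 2, u => re_form_self_nonneg m _

/-! ### Weak derivatives of test functions -/

theorem testFunctions_eq_zero_of_notMem (φ : testFunctions Ω) {x : EuclideanSpace ℝ (Fin d)}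
    (hx : x ∉ Ω) : φ.1 x = 0 := by
  by_contra h
  exact hx (φ.2.2.2 (subset_tsupport φ.1 h))

theorem testFunctions_integrable_mul (φ ψ : testFunctions Ω) :
    Integrable (fun x => φ.1 x * ψ.1 x) volume :=
  (φ.2.1.continuous.mul ψ.2.1.continuous).integrable_of_hasCompactSupport φ.2.2.1.mul_right

theorem testL2_mem_weakPartialGraph (i : Fin d) (φ : testFunctions Ω) :
    (testL2 φ, testL2 (testPartial i φ)) ∈ weakPartialGraph Ω i := by
  intro ψ hψ
  have h0 : ∀ f g : testFunctions Ω, ∫ x in Ω, f.1 x * testL2 g x = ∫ x, f.1 x * g.1 x := by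
    intro f g
    rw [← setIntegral_eq_integral_of_forall_compl_eq_zero (s := Ω)
      (f := fun x => f.1 x * g.1 x)
      fun x hx => by rw [testFunctions_eq_zero_of_notMem f hx, zero_mul]]
    refine integral_congr_ae ?_
    filter_upwards [coeFn_testL2 g] with x hx
    rw [hx]
  have h1 := h0 (testPartial i ⟨ψ, hψ⟩) φ
  have h2 := h0 ⟨ψ, hψ⟩ (testPartial i φ)
  refine h1.trans (Eq.trans ?_ (congrArg Neg.neg h2.symm))
  have h3 := integral_mul_fderiv_eq_neg_fderiv_mul_of_integrable (𝕜 := ℂ)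
    (v := EuclideanSpace.single i (1 : ℝ))
    (testFunctions_integrable_mul (testPartial i ⟨ψ, hψ⟩) φ)
    (testFunctions_integrable_mul ⟨ψ, hψ⟩ (testPartial i φ))
    (testFunctions_integrable_mul ⟨ψ, hψ⟩ φ)
    (fun x _ => testFunctions_differentiable ⟨ψ, hψ⟩ x)
    (fun x _ => testFunctions_differentiable φ x)
  exact (neg_eq_iff_eq_neg.2 h3).symm

theorem exists_sobolev_testL2 (hΩ : IsOpen Ω) : ∀ (m : ℕ) (φ : testFunctions Ω),
    ∃ v : sobolev Ω m, (v : L2 Ω) = testL2 φ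
  | 0, φ => ⟨⟨testL2 φ, Submodule.mem_top⟩, rfl⟩
  | m + 1, φ => by
    choose g hg using fun i => exists_sobolev_testL2 hΩ m (testPartial i φ)
    obtain ⟨v, hv, -⟩ := mem_sobolev_succ hΩ (u := testL2 φ) g fun i => by
      rw [hg]
      exact testL2_mem_weakPartialGraph i φ
    exact ⟨v, hv⟩

theorem exists_sobolevZero_testL2 (hΩ : IsOpen Ω) (m : ℕ) (φ : testFunctions Ω) :
    ∃ v ∈ sobolevZero Ω m, (v : L2 Ω) = testL2 φ := by
  obtain ⟨v, hv⟩ := exists_sobolev_testL2 hΩ m φ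
  refine ⟨v, mem_sobolevZero_iff.2 ⟨fun _ => v, fun _ => ⟨φ, hv⟩, ?_⟩, hv⟩
  simp [SobolevTendsto, sobolevNormSq_zero]

theorem sobolevPartial_testL2 (hΩ : IsOpen Ω) {m : ℕ} (i : Fin d) {v : sobolev Ω (m + 1)}
    {φ : testFunctions Ω} (hv : (v : L2 Ω) = testL2 φ) :
    (sobolevPartial Ω m i v : L2 Ω) = testL2 (testPartial i φ) := by
  have h := sobolevPartial_mem_graph hΩ i v
  rw [hv] at h
  exact weakPartialGraph_unique hΩ h (testL2_mem_weakPartialGraph i φ)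

/-- `-Δφ` for a test function `φ`. -/
def testNegLaplacian (φ : testFunctions Ω) : testFunctions Ω :=
  -∑ i, testPartial i (testPartial i φ)

theorem negLaplacian_testL2 (hΩ : IsOpen Ω) {m : ℕ} {v : sobolev Ω (m + 2)}
    {φ : testFunctions Ω} (hv : (v : L2 Ω) = testL2 φ) :
    (negLaplacian Ω m v : L2 Ω) = testL2 (testNegLaplacian φ) := by
  simp only [negLaplacian, testNegLaplacian, LinearMap.neg_apply, LinearMap.sum_apply,
    LinearMap.comp_apply, Submodule.coe_neg, Submodule.coe_sum,
    sobolevPartial_testL2 hΩ _ (sobolevPartial_testL2 hΩ _ hv)]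
  rw [map_neg, map_sum]

section Fourier

open scoped FourierTransform LineDeriv SchwartzMap

/-! ### Fourier representation of the form and of the Sobolev norm -/

/-- A test function as a Schwartz function. -/
def testSchwartz : testFunctions Ω →ₗ[ℂ] 𝓢(EuclideanSpace ℝ (Fin d), ℂ) where
  toFun φ := φ.2.2.1.toSchwartzMap φ.2.1
  map_add' _ _ := rfl
  map_smul' _ _ := rfl

theorem testSchwartz_testDeriv (v : EuclideanSpace ℝ (Fin d)) (φ : testFunctions Ω) :
    testSchwartz (testDeriv v φ) = ∂_{v} (testSchwartz φ) := by
  ext x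
  rw [SchwartzMap.lineDerivOp_apply_eq_fderiv]
  rfl

theorem fourier_testDeriv (v : EuclideanSpace ℝ (Fin d)) (φ : testFunctions Ω)
    (ξ : EuclideanSpace ℝ (Fin d)) :
    𝓕 (testSchwartz (testDeriv v φ)) ξ =
      (2 * Real.pi * Complex.I) * ((inner ℝ ξ v : ℝ) : ℂ) * 𝓕 (testSchwartz φ) ξ := by
  have h : (inner ℝ · v : EuclideanSpace ℝ (Fin d) → ℝ).HasTemperateGrowth :=
    ((innerSL ℝ).flip v).hasTemperateGrowth
  rw [testSchwartz_testDeriv, SchwartzMap.fourier_lineDerivOp_eq, smul_apply,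
    SchwartzMap.smulLeftCLM_apply_apply h]
  simp [mul_assoc]

theorem fourier_testNegLaplacian (φ : testFunctions Ω) (ξ : EuclideanSpace ℝ (Fin d)) :
    𝓕 (testSchwartz (testNegLaplacian φ)) ξ =
      (((2 * Real.pi * ‖ξ‖) ^ 2 : ℝ) : ℂ) * 𝓕 (testSchwartz φ) ξ := by
  have h : 𝓕 (testSchwartz (testNegLaplacian φ)) =
      -∑ i, 𝓕 (testSchwartz (testPartial i (testPartial i φ))) := by
    simp only [testNegLaplacian, map_neg, map_sum]
    rw [← SchwartzMap.fourierTransformCLM_apply ℂ, map_neg, map_sum]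
    rfl
  rw [h, neg_apply, sum_apply]
  simp only [fourier_testDeriv, EuclideanSpace.inner_single_right]
  rw [mul_pow, EuclideanSpace.norm_sq_eq]
  push_cast
  simp only [Finset.mul_sum, Finset.sum_mul, ← Finset.sum_neg_distrib]
  refine Finset.sum_congr rfl fun i _ => ?_
  have : ((‖ξ.ofLp i‖ : ℝ) : ℂ) ^ 2 = (ξ.ofLp i : ℂ) ^ 2 := by
    rw [← Complex.ofReal_pow, Real.norm_eq_abs, sq_abs, Complex.ofReal_pow]
  rw [this]
  simp
  ring_nf
  simp

/-- The square `|φ̂(ξ)|²` of the Fourier transform of a test function. -/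
def fourierSq (φ : testFunctions Ω) (ξ : EuclideanSpace ℝ (Fin d)) : ℝ :=
  ‖𝓕 (testSchwartz φ) ξ‖ ^ 2

theorem fourierSq_nonneg (φ : testFunctions Ω) (ξ : EuclideanSpace ℝ (Fin d)) :
    0 ≤ fourierSq φ ξ := sq_nonneg _

theorem continuous_fourierSq (φ : testFunctions Ω) : Continuous (fourierSq φ) :=
  ((𝓕 (testSchwartz φ)).continuous.norm).pow 2

theorem fourierSq_testDeriv (v : EuclideanSpace ℝ (Fin d)) (φ : testFunctions Ω)
    (ξ : EuclideanSpace ℝ (Fin d)) :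
    fourierSq (testDeriv v φ) ξ = (2 * Real.pi * inner ℝ ξ v) ^ 2 * fourierSq φ ξ := by
  simp only [fourierSq, fourier_testDeriv, norm_mul, mul_pow, Complex.norm_real, Complex.norm_I,
    Real.norm_eq_abs, sq_abs, Complex.norm_ofNat, mul_one]

theorem fourierSq_iterate_testDeriv (v : EuclideanSpace ℝ (Fin d)) (φ : testFunctions Ω)
    (ξ : EuclideanSpace ℝ (Fin d)) (m : ℕ) :
    fourierSq ((testDeriv v)^[m] φ) ξ =
      (2 * Real.pi * inner ℝ ξ v) ^ (2 * m) * fourierSq φ ξ := by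
  induction m with
  | zero => simp
  | succ m ih =>
    rw [Function.iterate_succ_apply', fourierSq_testDeriv, ih]
    ring

theorem fourierSq_testNegLaplacian (φ : testFunctions Ω) (ξ : EuclideanSpace ℝ (Fin d)) :
    fourierSq (testNegLaplacian φ) ξ = (2 * Real.pi * ‖ξ‖) ^ 4 * fourierSq φ ξ := by
  rw [fourierSq, fourierSq, fourier_testNegLaplacian, norm_mul, Complex.norm_real,
    Real.norm_of_nonneg (by positivity)]
  ring

theorem sum_fourierSq_testPartial (φ : testFunctions Ω) (ξ : EuclideanSpace ℝ (Fin d)) :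
    ∑ i, fourierSq (testPartial i φ) ξ = (2 * Real.pi * ‖ξ‖) ^ 2 * fourierSq φ ξ := by
  rw [mul_pow, EuclideanSpace.norm_sq_eq, Finset.mul_sum, Finset.sum_mul]
  refine Finset.sum_congr rfl fun i _ => ?_
  rw [fourierSq_testDeriv, EuclideanSpace.inner_single_right]
  simp [mul_pow]

theorem integrable_pow_mul_fourierSq (φ : testFunctions Ω) (k : ℕ) :
    Integrable (fun ξ => (2 * Real.pi * ‖ξ‖) ^ k * fourierSq φ ξ) := by
  obtain ⟨C, -, hC⟩ := (𝓕 (testSchwartz φ)).decay 0 0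
  have h := (((𝓕 (testSchwartz φ)).integrable_pow_mul volume k).mul_bdd (c := C)
    (𝓕 (testSchwartz φ)).continuous.norm.aestronglyMeasurable
    (Eventually.of_forall fun ξ => by simpa using hC ξ)).const_mul ((2 * Real.pi) ^ k)
  refine h.congr (Eventually.of_forall fun ξ => ?_)
  simp only [fourierSq]
  ring

/-- Plancherel's theorem. -/
theorem integral_norm_sq_testFunction (φ : testFunctions Ω) :
    ∫ x, ‖φ.1 x‖ ^ 2 = ∫ ξ, fourierSq φ ξ :=
  (SchwartzMap.integral_norm_sq_fourier (testSchwartz φ)).symm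

theorem norm_sq_testL2 (φ : testFunctions Ω) : ‖testL2 φ‖ ^ 2 = ∫ x, ‖φ.1 x‖ ^ 2 := by
  rw [← setIntegral_eq_integral_of_forall_compl_eq_zero (s := Ω)]
  · have h := L2.inner_def (𝕜 := ℂ) (testL2 φ) (testL2 φ)
    rw [inner_self_eq_norm_sq_to_K] at h
    have h2 : ∫ x in Ω, inner ℂ (testL2 φ x) (testL2 φ x) =
        ((∫ x in Ω, ‖φ.1 x‖ ^ 2 : ℝ) : ℂ) := by
      rw [← integral_complex_ofReal]
      refine integral_congr_ae ?_
      filter_upwards [coeFn_testL2 φ] with x hx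
      rw [hx, inner_self_eq_norm_sq_to_K]
      simp
    rw [h2] at h
    exact Complex.ofReal_injective (by simpa using h)
  · intro x hx
    simp [testFunctions_eq_zero_of_notMem φ hx]

theorem form_testL2 (hΩ : IsOpen Ω) : ∀ (m : ℕ) (φ : testFunctions Ω) (v : sobolev Ω m),
    (v : L2 Ω) = testL2 φ →
    (form Ω m v v).re = ∫ ξ, (2 * Real.pi * ‖ξ‖) ^ (2 * m) * fourierSq φ ξ
  | 0, φ, v, hv => by
    have h : (form Ω 0 v v).re = ‖(v : L2 Ω)‖ ^ 2 := (norm_sq_eq_re_inner (𝕜 := ℂ) (v : L2 Ω)).symm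
    rw [h, hv, norm_sq_testL2, integral_norm_sq_testFunction]
    simp
  | 1, φ, v, hv => by
    have h : (form Ω 1 v v).re = ∑ i, ‖testL2 (testPartial i φ)‖ ^ 2 := by
      simp only [form, Complex.re_sum, sobolevPartial_testL2 hΩ _ hv]
      exact Finset.sum_congr rfl fun i _ => (norm_sq_eq_re_inner (𝕜 := ℂ) _).symm
    simp only [h, norm_sq_testL2, integral_norm_sq_testFunction]
    rw [← integral_finsetSum]
    · simp only [sum_fourierSq_testPartial, mul_one]
    · intro i _
      simpa using integrable_pow_mul_fourierSq (testPartial i φ) 0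
  | m + 2, φ, v, hv => by
    have h := form_testL2 hΩ m _ _ (negLaplacian_testL2 hΩ hv)
    rw [form, h]
    congr 1 with ξ
    rw [fourierSq_testNegLaplacian]
    ring

theorem sobolevNormSq_testL2 (hΩ : IsOpen Ω) : ∀ (m : ℕ) (φ : testFunctions Ω) (v : sobolev Ω m),
    (v : L2 Ω) = testL2 φ → sobolevNormSq Ω m v =
      ∫ ξ, (∑ k ∈ Finset.range (m + 1), (2 * Real.pi * ‖ξ‖) ^ (2 * k)) * fourierSq φ ξ
  | 0, φ, v, hv => by
    rw [sobolevNormSq, hv, norm_sq_testL2, integral_norm_sq_testFunction]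
    simp
  | m + 1, φ, v, hv => by
    have hi : ∀ (n : ℕ) (ψ : testFunctions Ω), Integrable fun ξ =>
        (∑ k ∈ Finset.range n, (2 * Real.pi * ‖ξ‖) ^ (2 * k)) * fourierSq ψ ξ := by
      intro n ψ
      simp only [Finset.sum_mul]
      exact integrable_finsetSum _ fun k _ => integrable_pow_mul_fourierSq ψ (2 * k)
    have h := fun i => sobolevNormSq_testL2 hΩ m _ _ (sobolevPartial_testL2 hΩ i hv)
    have h0 : Integrable (fun ξ => fourierSq φ ξ) := by
      simpa using integrable_pow_mul_fourierSq φ 0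
    simp only [sobolevNormSq, h]
    rw [hv, norm_sq_testL2, integral_norm_sq_testFunction,
      ← integral_finsetSum _ fun i _ => hi _ _,
      ← integral_add h0 (integrable_finsetSum _ fun i _ => hi _ _)]
    congr 1 with ξ
    rw [← Finset.mul_sum, sum_fourierSq_testPartial, Finset.sum_range_succ' _ (m + 1),
      ← mul_assoc, Finset.sum_mul, add_mul, add_comm]
    simp only [mul_zero, pow_zero, one_mul]
    congr 2
    refine Finset.sum_congr rfl fun k _ => ?_
    ring

/-- On test functions the form controls the full Sobolev norm, since
`|ξ|^{2k} ≤ 1 + |ξ|^{2m}` for `k ≤ m`. -/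
theorem sobolevNormSq_le_testL2 (hΩ : IsOpen Ω) {m : ℕ} {φ : testFunctions Ω} {v : sobolev Ω m}
    (hv : (v : L2 Ω) = testL2 φ) :
    sobolevNormSq Ω m v ≤ (m + 1) * (‖(v : L2 Ω)‖ ^ 2 + (form Ω m v v).re) := by
  have h0 : Integrable (fun ξ => fourierSq φ ξ) := by
    simpa using integrable_pow_mul_fourierSq φ 0
  rw [sobolevNormSq_testL2 hΩ m φ v hv, form_testL2 hΩ m φ v hv, hv, norm_sq_testL2,
    integral_norm_sq_testFunction, ← integral_add h0 (integrable_pow_mul_fourierSq φ _),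
    ← integral_const_mul]
  refine integral_mono ?_ ((h0.add (integrable_pow_mul_fourierSq φ _)).const_mul _) fun ξ => ?_
  · simp only [Finset.sum_mul]
    exact integrable_finsetSum _ fun k _ => integrable_pow_mul_fourierSq φ (2 * k)
  · simp only
    have ht : (0 : ℝ) ≤ 2 * Real.pi * ‖ξ‖ := by positivity
    generalize 2 * Real.pi * ‖ξ‖ = t at ht
    have h1 : ∑ k ∈ Finset.range (m + 1), t ^ (2 * k) ≤ (m + 1) * (1 + t ^ (2 * m)) := by
      refine (Finset.sum_le_card_nsmul _ _ (1 + t ^ (2 * m)) fun k hk => ?_).trans_eq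
        (by rw [Finset.card_range, nsmul_eq_mul]; push_cast; ring)
      have hk' : 2 * k ≤ 2 * m := by have := Finset.mem_range.1 hk; omega
      rcases le_total t 1 with h | h
      · exact (pow_le_one₀ ht h).trans (le_add_of_nonneg_right (by positivity))
      · exact (pow_le_pow_right₀ h hk').trans (le_add_of_nonneg_left zero_le_one)
    calc _ ≤ ((m + 1) * (1 + t ^ (2 * m))) * fourierSq φ ξ :=
          mul_le_mul_of_nonneg_right h1 (fourierSq_nonneg φ ξ)
      _ = _ := by ring

end Fourier

/-! ### From the form inequality on test functions to the spectrum -/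

theorem sobolevNormSq_le_of_mem_sobolevZero (hΩ : IsOpen Ω) {m : ℕ} {u : sobolev Ω m}
    (hu : u ∈ sobolevZero Ω m) :
    sobolevNormSq Ω m u ≤ (m + 1) * (‖(u : L2 Ω)‖ ^ 2 + (form Ω m u u).re) := by
  obtain ⟨w, hw, hwu⟩ := mem_sobolevZero_iff.1 hu
  refine le_of_tendsto_of_tendsto' hwu.tendsto_sobolevNormSq
    (((hwu.coe.norm.pow 2).add
      ((Complex.continuous_re.tendsto _).comp (hwu.tendsto_form hwu))).const_mul _) fun n => ?_
  obtain ⟨φ, hφ⟩ := hw n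
  exact sobolevNormSq_le_testL2 hΩ hφ

theorem le_re_form_of_mem_sobolevZero (hΩ : IsOpen Ω) {m : ℕ} {c : ℝ}
    (h : ∀ φ : testFunctions Ω,
      c * ∫ x, ‖φ.1 x‖ ^ 2 ≤ ∫ ξ, (2 * Real.pi * ‖ξ‖) ^ (2 * m) * fourierSq φ ξ)
    {u : sobolev Ω m} (hu : u ∈ sobolevZero Ω m) :
    c * ‖(u : L2 Ω)‖ ^ 2 ≤ (form Ω m u u).re := by
  obtain ⟨w, hw, hwu⟩ := mem_sobolevZero_iff.1 hu
  refine le_of_tendsto_of_tendsto' ((hwu.coe.norm.pow 2).const_mul c)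
    ((Complex.continuous_re.tendsto _).comp (hwu.tendsto_form hwu)) fun n => ?_
  obtain ⟨φ, hφ⟩ := hw n
  rw [Function.comp_apply, form_testL2 hΩ m φ (w n) hφ, hφ, norm_sq_testL2]
  exact h φ

theorem form_add_left (m : ℕ) (u v w : sobolev Ω m) :
    form Ω m (u + v) w = form Ω m u w + form Ω m v w := by
  rw [← form_conj_symm, form_add_right, map_add, form_conj_symm, form_conj_symm]

theorem form_smul_left (m : ℕ) (a : ℂ) (u v : sobolev Ω m) :
    form Ω m (a • u) v = starRingEnd ℂ a * form Ω m u v := by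
  rw [← form_conj_symm, form_smul_right, map_mul, form_conj_symm]

theorem form_zero_left (m : ℕ) (v : sobolev Ω m) : form Ω m 0 v = 0 := by
  have h := form_smul_left m 0 (0 : sobolev Ω m) v
  simpa using h

theorem snd_eq_zero_of_mem_dirichletPolyharmonicGraph (hΩ : IsOpen Ω) (m : ℕ) :
    ∀ p ∈ dirichletPolyharmonicGraph Ω m, p.1 = 0 → p.2 = 0 := by
  rintro ⟨_, f⟩ ⟨u, hu, rfl, h⟩ hu0
  have hu0 : u = 0 := Subtype.ext hu0
  refine eq_zero_of_inner_testL2 hΩ fun φ => ?_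
  obtain ⟨v, hv, hvφ⟩ := exists_sobolevZero_testL2 hΩ m φ
  rw [← hvφ, ← h v hv, hu0, ← form_conj_symm, form_zero_left, map_zero]

theorem mem_dirichletPolyharmonicGraph (hΩ : IsOpen Ω) (m : ℕ)
    (u : (dirichletPolyharmonic Ω m).domain) :
    ((u : L2 Ω), dirichletPolyharmonic Ω m u) ∈ dirichletPolyharmonicGraph Ω m :=
  Submodule.mem_graph_toLinearPMap (snd_eq_zero_of_mem_dirichletPolyharmonicGraph hΩ m) u

theorem dirichletPolyharmonic_eq (hΩ : IsOpen Ω) {m : ℕ} {u f : L2 Ω}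
    (h : (u, f) ∈ dirichletPolyharmonicGraph Ω m) :
    ∃ hu : u ∈ (dirichletPolyharmonic Ω m).domain, dirichletPolyharmonic Ω m ⟨u, hu⟩ = f := by
  have hu : u ∈ (dirichletPolyharmonic Ω m).domain := ⟨_, h, rfl⟩
  exact ⟨hu, sub_eq_zero.1 (snd_eq_zero_of_mem_dirichletPolyharmonicGraph hΩ m _
    (Submodule.sub_mem _ (mem_dirichletPolyharmonicGraph hΩ m ⟨u, hu⟩) h) (sub_self u))⟩

/-- The inner product `h[u, v] - μ ⟨u, v⟩` on `H^m_0(Ω)`, for `μ` below a lower bound of the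
form. -/
@[reducible]
def shiftedCore (m : ℕ) (c μ : ℝ) (hμ : μ < c)
    (hc : ∀ u ∈ sobolevZero Ω m, c * ‖(u : L2 Ω)‖ ^ 2 ≤ (form Ω m u u).re) :
    InnerProductSpace.Core ℂ (sobolevZero Ω m) where
  inner u v := form Ω m u v - (μ : ℂ) * inner ℂ ((u : sobolev Ω m) : L2 Ω) (v : sobolev Ω m)
  conj_inner_symm u v := by
    rw [map_sub, map_mul, form_conj_symm, inner_conj_symm, Complex.conj_ofReal]
  re_inner_nonneg u := by
    have h := hc u u.2
    have h2 := sq_nonneg ‖((u : sobolev Ω m) : L2 Ω)‖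
    rw [inner_self_eq_norm_sq_to_K]
    change 0 ≤ (form Ω m u u - (μ : ℂ) * ((‖((u : sobolev Ω m) : L2 Ω)‖ : ℝ) : ℂ) ^ 2).re
    rw [← Complex.ofReal_pow, ← Complex.ofReal_mul, Complex.sub_re, Complex.ofReal_re]
    nlinarith
  add_left u v w := by
    simp only [Submodule.coe_add, form_add_left, inner_add_left]
    ring
  smul_left u v a := by
    simp only [Submodule.coe_smul, form_smul_left, inner_smul_left]
    ring
  definite u hu := by
    have h := hc u u.2
    rw [inner_self_eq_norm_sq_to_K] at hu
    replace hu := congrArg Complex.re hu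
    change (form Ω m u u - (μ : ℂ) * ((‖((u : sobolev Ω m) : L2 Ω)‖ : ℝ) : ℂ) ^ 2).re = 0 at hu
    rw [← Complex.ofReal_pow, ← Complex.ofReal_mul, Complex.sub_re, Complex.ofReal_re] at hu
    have h0 : (c - μ) * ‖((u : sobolev Ω m) : L2 Ω)‖ ^ 2 ≤ 0 := by linarith
    have h1 : ‖((u : sobolev Ω m) : L2 Ω)‖ ^ 2 ≤ 0 := by
      by_contra h2
      exact absurd h0 (not_le.2 (mul_pos (sub_pos.2 hμ) (not_le.1 h2)))
    have h2 : ((u : sobolev Ω m) : L2 Ω) = 0 := by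
      rw [← norm_eq_zero]
      exact pow_eq_zero_iff two_ne_zero |>.1 (le_antisymm h1 (sq_nonneg _))
    exact Subtype.ext (Subtype.ext h2)

theorem re_shiftedCore (m : ℕ) (c μ : ℝ) (hμ : μ < c)
    (hc : ∀ u ∈ sobolevZero Ω m, c * ‖(u : L2 Ω)‖ ^ 2 ≤ (form Ω m u u).re)
    (u : sobolevZero Ω m) :
    ((shiftedCore m c μ hμ hc).inner u u).re =
      (form Ω m u u).re - μ * ‖((u : sobolev Ω m) : L2 Ω)‖ ^ 2 := by
  change (form Ω m u u - (μ : ℂ) * inner ℂ ((u : sobolev Ω m) : L2 Ω) (u : sobolev Ω m)).re = _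
  rw [inner_self_eq_norm_sq_to_K]
  change (form Ω m u u - (μ : ℂ) * ((‖((u : sobolev Ω m) : L2 Ω)‖ : ℝ) : ℂ) ^ 2).re = _
  rw [← Complex.ofReal_pow, ← Complex.ofReal_mul, Complex.sub_re, Complex.ofReal_re]

/-- Every real `μ` below a lower bound of the form is in the resolvent set: `H^m_0(Ω)` is complete
for `h[u, v] - μ ⟨u, v⟩`, and the representation of the functionals `⟨·, g⟩` in this Hilbert space
solves `(A - μ) u = g`. -/
theorem mem_resolventSet_of_lt (hΩ : IsOpen Ω) {m : ℕ} {c μ : ℝ} (hμ : μ < c)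
    (hc : ∀ u ∈ sobolevZero Ω m, c * ‖(u : L2 Ω)‖ ^ 2 ≤ (form Ω m u u).re) :
    (μ : ℂ) ∈ resolventSet (dirichletPolyharmonic Ω m) := by
  let core := shiftedCore m c μ hμ hc
  have hcore : ∀ u : sobolevZero Ω m, (core.inner u u).re =
      (form Ω m u u).re - μ * ‖((u : sobolev Ω m) : L2 Ω)‖ ^ 2 := re_shiftedCore m c μ hμ hc
  have hpos : 0 < c - μ := sub_pos.2 hμ
  let T : sobolevZero Ω m →ₗ[ℂ] L2 Ω := (sobolev Ω m).subtype ∘ₗ (sobolevZero Ω m).subtype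
  have hT : ∀ v, ‖T v‖ ^ 2 ≤ (c - μ)⁻¹ * (core.inner v v).re := by
    intro v
    rw [hcore, le_inv_mul_iff₀ hpos]
    have h1 := hc v v.2
    change (c - μ) * ‖((v : sobolev Ω m) : L2 Ω)‖ ^ 2 ≤ _
    linarith
  -- the shifted form controls the Sobolev norm: `‖u‖² ≤ core / (c - μ)`, `h[u] ≤ core + |μ| ‖u‖²`
  let K : ℝ := (m + 1) * (1 + (1 + |μ|) * (c - μ)⁻¹)
  have hK : 0 < K := by positivity
  have hS : ∀ v : sobolevZero Ω m, sobolevNormSq Ω m v ≤ K * (core.inner v v).re := by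
    intro v
    refine (sobolevNormSq_le_of_mem_sobolevZero hΩ v.2).trans ?_
    rw [mul_assoc]
    refine mul_le_mul_of_nonneg_left ?_ (by positivity)
    have h1 := hT v
    change ‖((v : sobolev Ω m) : L2 Ω)‖ ^ 2 ≤ _ at h1
    have h2 := mul_le_mul_of_nonneg_left h1 (by positivity : 0 ≤ 1 + |μ|)
    have h3 := mul_le_mul_of_nonneg_right (le_abs_self μ)
      (sq_nonneg ‖((v : sobolev Ω m) : L2 Ω)‖)
    have h4 := hcore v
    linarith
  obtain ⟨R, hR⟩ := exists_clm_of_core_complete core T _ hT fun u hu => by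
    obtain ⟨v, hv⟩ := sobolev_complete hΩ m (fun n => (u n : sobolev Ω m)) fun ε hε => by
      obtain ⟨N, hN⟩ := hu (ε / K) (by positivity)
      refine ⟨N, fun a ha b hb => (hS (u a - u b)).trans_lt ?_⟩
      rw [mul_comm]
      exact (lt_div_iff₀ hK).1 (hN a ha b hb)
    refine ⟨⟨v, sobolevZero_closed (fun n => (u n).2) hv⟩, ?_⟩
    have h0 : SobolevTendsto m (fun n => (u n : sobolev Ω m) - v) 0 := by
      simpa only [SobolevTendsto, sub_zero] using hv
    have h1 := ((Complex.continuous_re.tendsto _).comp (h0.tendsto_form h0)).sub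
      ((h0.coe.norm.pow 2).const_mul μ)
    rw [form_zero_left] at h1
    simp only [hcore]
    simpa using h1
  have hinj : ∀ v w : sobolevZero Ω m, (∀ z, core.inner z v = core.inner z w) → v = w := by
    intro v w h
    have h1 : T (v - w) = 0 := by
      have h2 := hT (v - w)
      have h3 : core.inner (v - w) (v - w) = 0 := by
        have h4 : core.inner (v - w) (v - w) = core.inner (v - w) v - core.inner (v - w) w := by
          have h5 : core.inner (v - w) v = core.inner (v - w) (v - w) + core.inner (v - w) w := by
            rw [← core.conj_inner_symm (v - w) v, ← core.conj_inner_symm (v - w) (v - w),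
              ← core.conj_inner_symm (v - w) w, ← map_add, ← core.add_left, sub_add_cancel]
          rw [h5, add_sub_cancel_right]
        rw [h4, h, sub_self]
      rw [h3, Complex.zero_re, mul_zero] at h2
      exact norm_eq_zero.1 (pow_eq_zero_iff two_ne_zero |>.1 (le_antisymm h2 (sq_nonneg _)))
    exact sub_eq_zero.1 (Subtype.ext (Subtype.ext h1))
  have hker : ∀ w v : sobolevZero Ω m, core.inner w v =
      form Ω m w v - (μ : ℂ) * inner ℂ (T w) (T v) := fun _ _ => rfl
  refine ⟨R, fun g => ?_, fun u => ?_⟩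
  · obtain ⟨v, hv, hvg⟩ := hR g
    have hmem : (R g, g + (μ : ℂ) • R g) ∈ dirichletPolyharmonicGraph Ω m := by
      refine ⟨v, v.2, hv.symm, fun w hw => ?_⟩
      have h := hvg ⟨w, hw⟩
      rw [hker, sub_eq_iff_eq_add] at h
      refine h.trans ?_
      rw [inner_add_right, inner_smul_right, hv]
      rfl
    obtain ⟨hd, he⟩ := dirichletPolyharmonic_eq hΩ hmem
    exact ⟨hd, by rw [he, add_sub_cancel_right]⟩
  · obtain ⟨w, hw, hwu, hform⟩ := mem_dirichletPolyharmonicGraph hΩ m u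
    obtain ⟨v, hv, hvg⟩ := hR (dirichletPolyharmonic Ω m u - (μ : ℂ) • (u : L2 Ω))
    have hvw : v = ⟨w, hw⟩ := hinj _ _ fun z => by
      rw [hvg, hker, inner_sub_right, inner_smul_right]
      congr 1
      · exact (hform z z.2).symm
      · change _ = (μ : ℂ) * inner ℂ (T z) (w : L2 Ω)
        rw [hwu]
    rw [hv, hvw]
    exact hwu

theorem le_lambda (hΩ : IsOpen Ω) {m : ℕ} {c : ℝ}
    (h : ∀ φ : testFunctions Ω,
      c * ∫ x, ‖φ.1 x‖ ^ 2 ≤ ∫ ξ, (2 * Real.pi * ‖ξ‖) ^ (2 * m) * fourierSq φ ξ) :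
    (c : EReal) ≤ lambda Ω m := by
  refine le_iInf₂ fun μ hμ => ?_
  rw [EReal.coe_le_coe_iff]
  by_contra hlt
  exact hμ (mem_resolventSet_of_lt hΩ (not_le.1 hlt)
    fun u hu => le_re_form_of_mem_sobolevZero hΩ h hu)

/-! ### The exit time of a ray -/

/-- The set of times `t ≥ 0` at which the ray `x + t θ` is outside `Ω`. -/
def exitTimes (Ω : Set (EuclideanSpace ℝ (Fin d))) (θ x : EuclideanSpace ℝ (Fin d)) : Set ℝ :=
  {t | 0 ≤ t ∧ x + t • θ ∉ Ω}

/-- The reciprocal of the distance from `x` to the complement of `Ω` along the ray in the direction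
`θ`. If the ray never leaves `Ω`, then `sInf ∅ = 0` and `0⁻¹ = 0` give the value `0`, as they
should; the value is also `0` for `x ∉ Ω`. -/
def invExit (Ω : Set (EuclideanSpace ℝ (Fin d))) (θ x : EuclideanSpace ℝ (Fin d)) : ℝ :=
  (sInf (exitTimes Ω θ x))⁻¹

variable {θ x : EuclideanSpace ℝ (Fin d)}

theorem invExit_nonneg : 0 ≤ invExit Ω θ x :=
  inv_nonneg.2 (Real.sInf_nonneg fun _ ht => ht.1)

theorem isLeast_exitTimes (hΩ : IsOpen Ω) (h : (exitTimes Ω θ x).Nonempty) :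
    IsLeast (exitTimes Ω θ x) (sInf (exitTimes Ω θ x)) := by
  have hcl : IsClosed (exitTimes Ω θ x) :=
    isClosed_Ici.inter (hΩ.isClosed_compl.preimage (f := fun t : ℝ => x + t • θ) (by fun_prop))
  exact hcl.isLeast_csInf h ⟨0, fun t ht => ht.1⟩

theorem invExit_eq_inv_of_isLeast {a : ℝ} (h : IsLeast (exitTimes Ω θ x) a) :
    invExit Ω θ x = a⁻¹ := by
  rw [invExit, h.csInf_eq]

theorem invExit_eq_zero (h : ¬(exitTimes Ω θ x).Nonempty) : invExit Ω θ x = 0 := by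
  rw [invExit, Set.not_nonempty_iff_eq_empty.1 h, Real.sInf_empty, inv_zero]

theorem pos_of_mem_exitTimes (hx : x ∈ Ω) {t : ℝ} (ht : t ∈ exitTimes Ω θ x) : 0 < t := by
  refine lt_of_le_of_ne ht.1 fun h => ht.2 ?_
  rw [← h, zero_smul, add_zero]
  exact hx

theorem le_invExit_iff (hΩ : IsOpen Ω) {a : ℝ} (ha : 0 < a) :
    a ≤ invExit Ω θ x ↔ x ∈ Ω ∧ ∃ t ∈ Set.Icc 0 a⁻¹, x + t • θ ∉ Ω := by
  constructor
  · intro h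
    have hne : (exitTimes Ω θ x).Nonempty := by
      by_contra hne
      rw [invExit_eq_zero hne] at h
      linarith
    have hl := isLeast_exitTimes hΩ hne
    rw [invExit_eq_inv_of_isLeast hl] at h
    have hpos : 0 < sInf (exitTimes Ω θ x) := inv_pos.1 (ha.trans_le h)
    refine ⟨?_, _, ⟨hpos.le, (le_inv_comm₀ ha hpos).1 h⟩, hl.1.2⟩
    by_contra hx
    exact hpos.not_ge (hl.2 ⟨le_rfl, by rwa [zero_smul, add_zero]⟩)
  · rintro ⟨hx, t, ⟨ht, hta⟩, hto⟩
    have hl := isLeast_exitTimes hΩ ⟨t, ht, hto⟩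
    rw [invExit_eq_inv_of_isLeast hl, le_inv_comm₀ ha (pos_of_mem_exitTimes hx hl.1)]
    exact (hl.2 ⟨ht, hto⟩).trans hta

theorem add_smul_mem_of_mul_invExit_lt (hΩ : IsOpen Ω) (hx : x ∈ Ω) {t : ℝ} (ht : 0 < t)
    (h : t * invExit Ω θ x < 1) : x + t • θ ∈ Ω := by
  by_contra ho
  have h1 := (le_invExit_iff (Ω := Ω) (θ := θ) (x := x) hΩ (inv_pos.2 ht)).2
    ⟨hx, t, ⟨ht.le, (inv_inv t).ge⟩, ho⟩
  exact h.not_ge ((inv_le_iff_one_le_mul₀' ht).1 h1)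

theorem invExit_le_of_ball_subset (hΩ : IsOpen Ω) (hθ : ‖θ‖ = 1) {ε : ℝ} (hε : 0 < ε)
    (h : Metric.ball x ε ⊆ Ω) : invExit Ω θ x ≤ ε⁻¹ := by
  by_cases hne : (exitTimes Ω θ x).Nonempty
  · have hl := isLeast_exitTimes hΩ hne
    rw [invExit_eq_inv_of_isLeast hl]
    refine inv_anti₀ hε (not_lt.1 fun hlt => hl.1.2 (h ?_))
    rw [Metric.mem_ball, dist_self_add_left, norm_smul, hθ, mul_one,
      Real.norm_of_nonneg hl.1.1]
    exact hlt
  · rw [invExit_eq_zero hne]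
    positivity

theorem measurable_invExit (hΩ : IsOpen Ω) :
    Measurable fun p : EuclideanSpace ℝ (Fin d) × EuclideanSpace ℝ (Fin d) =>
      invExit Ω p.1 p.2 := by
  refine measurable_of_Ici fun a => ?_
  rcases le_or_gt a 0 with ha | ha
  · convert MeasurableSet.univ
    exact Set.eq_univ_of_forall fun p => ha.trans invExit_nonneg
  have hopen : IsOpen {p : EuclideanSpace ℝ (Fin d) × EuclideanSpace ℝ (Fin d) |
      ∀ t ∈ Set.Icc 0 a⁻¹, p.2 + t • p.1 ∈ Ω} := by
    refine isOpen_iff_mem_nhds.2 fun p hp => ?_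
    refine isCompact_Icc.eventually_forall_of_forall_eventually fun t ht => ?_
    have hc : Continuous fun q : (EuclideanSpace ℝ (Fin d) × EuclideanSpace ℝ (Fin d)) × ℝ =>
        q.1.2 + q.2 • q.1.1 := by fun_prop
    exact (hΩ.preimage hc).mem_nhds (hp t ht)
  convert (measurable_snd hΩ.measurableSet).inter hopen.measurableSet.compl using 1
  ext p
  simp [le_invExit_iff hΩ ha, and_assoc]

theorem _root_.Measurable.invExit {α : Type*} [MeasurableSpace α]
    {f g : α → EuclideanSpace ℝ (Fin d)} (hΩ : IsOpen Ω) (hf : Measurable f) (hg : Measurable g) :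
    Measurable fun a => invExit Ω (f a) (g a) :=
  (measurable_invExit hΩ).comp (f := fun a => (f a, g a)) (hf.prodMk hg)

/-- Along the ray, `δ' = -1` for the exit time `δ`, hence `w' = w²` for `w = 1 / δ`. -/
theorem hasLineDerivAt_invExit (hΩ : IsOpen Ω) (hx : x ∈ Ω) :
    HasLineDerivAt ℝ (invExit Ω θ) (invExit Ω θ x ^ 2) x θ := by
  have hcont : Continuous fun s : ℝ => x + s • θ := by fun_prop
  obtain ⟨ε, hε, hball⟩ := Metric.isOpen_iff.1 (hΩ.preimage hcont) 0 (by simpa using hx)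
  have hmem : ∀ s : ℝ, |s| < ε → x + s • θ ∈ Ω := fun s hs =>
    hball (by simpa [Real.dist_eq] using hs)
  have hshift : ∀ s : ℝ, |s| < ε → ∀ t, t ∈ exitTimes Ω θ (x + s • θ) ↔
      s + t ∈ exitTimes Ω θ x := by
    intro s hs t
    have he : x + s • θ + t • θ = x + (s + t) • θ := by rw [add_smul, add_assoc]
    have hs' := abs_lt.1 hs
    constructor
    · rintro ⟨ht, ho⟩
      rw [he] at ho
      refine ⟨not_lt.1 fun hlt => ho (hmem _ (abs_lt.2 ⟨?_, ?_⟩)), ho⟩ <;> linarith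
    · rintro ⟨ht, ho⟩
      refine ⟨not_lt.1 fun hlt => ho (hmem _ (abs_lt.2 ⟨?_, ?_⟩)), he ▸ ho⟩ <;> linarith
  have hnear : ∀ᶠ s : ℝ in 𝓝 0, |s| < ε := by
    simpa using (continuous_abs.tendsto (0 : ℝ)).eventually (gt_mem_nhds (by simpa using hε))
  by_cases hne : (exitTimes Ω θ x).Nonempty
  · have hl := isLeast_exitTimes hΩ hne
    have hpos := pos_of_mem_exitTimes hx hl.1
    rw [invExit_eq_inv_of_isLeast hl]
    generalize sInf (exitTimes Ω θ x) = a at hl hpos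
    have h1 : HasDerivAt (fun s : ℝ => (a - s)⁻¹) ((a⁻¹) ^ 2) 0 := by
      have h2 := ((hasDerivAt_id (0 : ℝ)).const_sub a).fun_inv (by simpa using hpos.ne')
      exact h2.congr_deriv (by simp)
    refine h1.congr_of_eventuallyEq ?_
    filter_upwards [hnear] with s hs
    refine invExit_eq_inv_of_isLeast ⟨?_, fun t ht => ?_⟩
    · rw [hshift s hs, add_sub_cancel]
      exact hl.1
    · have := hl.2 ((hshift s hs t).1 ht)
      linarith
  · rw [invExit_eq_zero hne, zero_pow two_ne_zero]
    refine (hasDerivAt_const (0 : ℝ) (0 : ℝ)).congr_of_eventuallyEq ?_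
    filter_upwards [hnear] with s hs
    exact invExit_eq_zero fun ⟨t, ht⟩ => hne ⟨_, (hshift s hs t).1 ht⟩

/-! ### The Hardy inequality along a direction -/

theorem exists_invExit_le (hΩ : IsOpen Ω) {K : Set (EuclideanSpace ℝ (Fin d))} (hK : IsCompact K)
    (hKΩ : K ⊆ Ω) : ∃ B, 0 ≤ B ∧ ∀ θ, ‖θ‖ = 1 → ∀ x ∈ K, invExit Ω θ x ≤ B := by
  obtain ⟨ε, hε, h⟩ := hK.exists_thickening_subset_open hΩ hKΩ
  exact ⟨ε⁻¹, by positivity, fun θ hθ x hx => invExit_le_of_ball_subset hΩ hθ hε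
    ((Metric.ball_subset_thickening hx ε).trans h)⟩

theorem integrable_mul_invExit_pow (hΩ : IsOpen Ω) (hθ : ‖θ‖ = 1) (φ : testFunctions Ω)
    {f : EuclideanSpace ℝ (Fin d) → ℝ} (hf : Continuous f) (hs : ∀ x, φ.1 x = 0 → f x = 0)
    (n : ℕ) : Integrable fun x => f x * invExit Ω θ x ^ n := by
  have hK : IsCompact (tsupport φ.1) := φ.2.2.1
  obtain ⟨B, hB0, hB⟩ := exists_invExit_le hΩ hK φ.2.2.2
  have hfs : HasCompactSupport f := by
    refine φ.2.2.1.mono fun x hx => ?_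
    rw [Function.mem_support] at hx ⊢
    exact fun h => hx (hs x h)
  have hmeas : Measurable (invExit Ω θ) := measurable_const.invExit hΩ measurable_id
  have hmeas' : AEStronglyMeasurable
      ((tsupport φ.1).indicator fun x => invExit Ω θ x ^ n) volume :=
    ((hmeas.pow_const n).indicator (isClosed_tsupport φ.1).measurableSet).aestronglyMeasurable
  have hbdd : ∀ x, ‖(tsupport φ.1).indicator (fun x => invExit Ω θ x ^ n) x‖ ≤ B ^ n := by
    intro x
    by_cases hx : x ∈ tsupport φ.1
    · rw [Set.indicator_of_mem hx, Real.norm_of_nonneg (pow_nonneg invExit_nonneg n)]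
      exact pow_le_pow_left₀ invExit_nonneg (hB θ hθ x hx) n
    · rw [Set.indicator_of_notMem hx, norm_zero]
      exact pow_nonneg hB0 n
  refine ((hf.integrable_of_hasCompactSupport hfs (μ := volume)).mul_bdd hmeas'
    (Eventually.of_forall hbdd)).congr (Eventually.of_forall fun x => ?_)
  by_cases hx : x ∈ tsupport φ.1
  · simp only [Set.indicator_of_mem hx]
  · simp only [hs x (image_eq_zero_of_notMem_tsupport hx), zero_mul]

/-- The weighted Hardy inequality `((2k+1)/2)² ∫ |g|² δ^{-2k-2} ≤ ∫ |∂_θ g|² δ^{-2k}` for the exit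
time `δ` in the direction `θ`. It follows by expanding the square in
`0 ≤ ∫ |∂_θ g + (2k+1)/2 · w g|² w^{2k}`, `w = 1 / δ`, and integrating the mixed term by parts. -/
theorem hardy_step (hΩ : IsOpen Ω) (hθ : ‖θ‖ = 1) (g : testFunctions Ω) (k : ℕ) :
    ((2 * (k : ℝ) + 1) / 2) ^ 2 * ∫ x, ‖g.1 x‖ ^ 2 * invExit Ω θ x ^ (2 * (k + 1)) ≤
      ∫ x, ‖(testDeriv θ g).1 x‖ ^ 2 * invExit Ω θ x ^ (2 * k) := by
  have hcg := g.2.1.continuous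
  have hcd := (testDeriv θ g).2.1.continuous
  have hci : Continuous fun x => 2 * inner ℝ (g.1 x) ((testDeriv θ g).1 x) := by fun_prop
  have i1 : Integrable fun x => ‖g.1 x‖ ^ 2 * invExit Ω θ x ^ (2 * (k + 1)) :=
    integrable_mul_invExit_pow hΩ hθ g (by fun_prop) (fun x hx => by simp [hx]) _
  have i2 : Integrable fun x => ‖(testDeriv θ g).1 x‖ ^ 2 * invExit Ω θ x ^ (2 * k) :=
    integrable_mul_invExit_pow hΩ hθ (testDeriv θ g) (by fun_prop) (fun x hx => by simp [hx]) _
  have i3 : Integrable fun x =>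
      2 * inner ℝ (g.1 x) ((testDeriv θ g).1 x) * invExit Ω θ x ^ (2 * k + 1) :=
    integrable_mul_invExit_pow hΩ hθ g hci (fun x hx => by simp [hx]) _
  have i4 : Integrable fun x => ‖g.1 x‖ ^ 2 * invExit Ω θ x ^ (2 * k + 1) :=
    integrable_mul_invExit_pow hΩ hθ g (by fun_prop) (fun x hx => by simp [hx]) _
  have hw : ∀ x ∈ Ω, HasLineDerivAt ℝ (fun y => invExit Ω θ y ^ (2 * k + 1))
      ((2 * k + 1) * invExit Ω θ x ^ (2 * (k + 1))) x θ := by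
    intro x hx
    have h := HasDerivAt.fun_pow (hasLineDerivAt_invExit (θ := θ) hΩ hx) (2 * k + 1)
    simp only [zero_smul, add_zero, Nat.add_sub_cancel] at h
    refine HasDerivAt.congr_deriv h ?_
    push_cast
    ring
  have hg : ∀ x, HasLineDerivAt ℝ (fun y => ‖g.1 y‖ ^ 2)
      (2 * inner ℝ (g.1 x) ((testDeriv θ g).1 x)) x θ := by
    intro x
    have h := ((testFunctions_differentiable g x).hasFDerivAt.hasLineDerivAt θ).norm_sq
    simp only [zero_smul, add_zero] at h
    exact h
  have hsupp : tsupport (fun y => ‖g.1 y‖ ^ 2) ⊆ Ω :=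
    (closure_mono fun x (hx : _ ≠ _) => fun h => hx (by simp [h])).trans g.2.2.2
  have hparts := integral_bilinear_hasLineDerivAt_right_eq_neg_left_of_integrable
    (μ := (volume : Measure (EuclideanSpace ℝ (Fin d)))) (B := ContinuousLinearMap.mul ℝ ℝ)
    (f := fun y => ‖g.1 y‖ ^ 2) (f' := fun x => 2 * inner ℝ (g.1 x) ((testDeriv θ g).1 x))
    (g := fun y => invExit Ω θ y ^ (2 * k + 1))
    (g' := fun x => (2 * k + 1) * invExit Ω θ x ^ (2 * (k + 1))) (v := θ) i3
    ((i1.const_mul (2 * k + 1)).congr (Eventually.of_forall fun x => by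
      simp only [ContinuousLinearMap.mul_apply']; ring)) i4
    (fun x _ => hg x) (fun x hx => hw x (hsupp hx))
  simp only [ContinuousLinearMap.mul_apply'] at hparts
  have hparts' : (2 * (k : ℝ) + 1) * ∫ x, ‖g.1 x‖ ^ 2 * invExit Ω θ x ^ (2 * (k + 1)) =
      -∫ x, 2 * inner ℝ (g.1 x) ((testDeriv θ g).1 x) * invExit Ω θ x ^ (2 * k + 1) := by
    rw [← hparts, ← integral_const_mul]
    congr 1 with x
    ring
  have hsq : 0 ≤ ∫ x, (‖(testDeriv θ g).1 x‖ ^ 2 * invExit Ω θ x ^ (2 * k) +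
      (2 * (k : ℝ) + 1) / 2 *
        (2 * inner ℝ (g.1 x) ((testDeriv θ g).1 x) * invExit Ω θ x ^ (2 * k + 1)) +
      ((2 * (k : ℝ) + 1) / 2) ^ 2 * (‖g.1 x‖ ^ 2 * invExit Ω θ x ^ (2 * (k + 1)))) := by
    refine integral_nonneg fun x => ?_
    have h := norm_add_sq_real ((((2 * (k : ℝ) + 1) / 2) * invExit Ω θ x) • g.1 x)
      ((testDeriv θ g).1 x)
    rw [real_inner_smul_left, norm_smul, mul_pow, Real.norm_eq_abs, sq_abs] at h
    have h2 := mul_nonneg (sq_nonneg ‖(((2 * (k : ℝ) + 1) / 2) * invExit Ω θ x) • g.1 x +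
      (testDeriv θ g).1 x‖) (pow_nonneg (invExit_nonneg (Ω := Ω) (θ := θ) (x := x)) (2 * k))
    rw [h] at h2
    refine h2.trans_eq ?_
    ring
  have i23 : Integrable fun x => ‖(testDeriv θ g).1 x‖ ^ 2 * invExit Ω θ x ^ (2 * k) +
      (2 * (k : ℝ) + 1) / 2 *
        (2 * inner ℝ (g.1 x) ((testDeriv θ g).1 x) * invExit Ω θ x ^ (2 * k + 1)) :=
    i2.add (i3.const_mul _)
  rw [integral_add i23 (i1.const_mul _), integral_add i2 (i3.const_mul _),
    integral_const_mul, integral_const_mul] at hsq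
  have h3 : ∫ x, 2 * inner ℝ (g.1 x) ((testDeriv θ g).1 x) * invExit Ω θ x ^ (2 * k + 1) =
      -((2 * (k : ℝ) + 1) * ∫ x, ‖g.1 x‖ ^ 2 * invExit Ω θ x ^ (2 * (k + 1))) := by
    rw [hparts', neg_neg]
  rw [h3] at hsq
  nlinarith

/-- Birman's inequality along a direction, by iteration of the weighted Hardy inequality. -/
theorem birman (hΩ : IsOpen Ω) (hθ : ‖θ‖ = 1) (m : ℕ) (φ : testFunctions Ω) :
    (∏ k ∈ Finset.range m, ((2 * (k : ℝ) + 1) / 2) ^ 2) *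
      ∫ x, ‖φ.1 x‖ ^ 2 * invExit Ω θ x ^ (2 * m) ≤ ∫ x, ‖((testDeriv θ)^[m] φ).1 x‖ ^ 2 := by
  induction m generalizing φ with
  | zero => simp
  | succ m ih =>
    rw [Finset.prod_range_succ, Function.iterate_succ_apply, mul_assoc]
    exact (mul_le_mul_of_nonneg_left (hardy_step hΩ hθ φ m)
      (Finset.prod_nonneg fun _ _ => sq_nonneg _)).trans (ih (testDeriv θ φ))

/-! ### Moments of the uniform measure on the sphere -/

/-- Integration in polar coordinates of a product of an angular and a radial function. -/
theorem integral_eq_of_polar [NeZero d] (F : EuclideanSpace ℝ (Fin d) → ℝ)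
    (f : Metric.sphere (0 : EuclideanSpace ℝ (Fin d)) 1 → ℝ) (h : ℝ → ℝ)
    (hF : ∀ ρ > 0, ∀ θ : Metric.sphere (0 : EuclideanSpace ℝ (Fin d)) 1,
      F (ρ • (θ : EuclideanSpace ℝ (Fin d))) = f θ * h ρ) :
    ∫ x, F x = (∫ θ, f θ ∂(volume : Measure (EuclideanSpace ℝ (Fin d))).toSphere) *
      ∫ ρ : Set.Ioi (0 : ℝ), h ρ ∂Measure.volumeIoiPow (d - 1) := by
  calc ∫ x, F x = ∫ x : ({(0)}ᶜ : Set (EuclideanSpace ℝ (Fin d))), F x 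
          ∂(volume.comap Subtype.val) := by
        rw [integral_subtype_comap (measurableSet_singleton _).compl F, restrict_compl_singleton]
    _ = ∫ p, f p.1 * h p.2 ∂((volume : Measure (EuclideanSpace ℝ (Fin d))).toSphere.prod
          (.volumeIoiPow (d - 1))) := by
        have hp := (volume : Measure (EuclideanSpace ℝ (Fin d)))
          |>.measurePreserving_homeomorphUnitSphereProd
        rw [finrank_euclideanSpace_fin] at hp
        rw [← hp.integral_comp (Homeomorph.measurableEmbedding _)]
        congr 1 with x
        have hx : 0 < ‖(x : EuclideanSpace ℝ (Fin d))‖ := norm_pos_iff.2 x.2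
        rw [← hF _ (by simpa using hx)]
        congr 1
        simp [smul_smul, hx.ne']
    _ = _ := integral_prod_mul f fun ρ : Set.Ioi (0 : ℝ) => h ρ

/-- The Gaussian `exp (-‖x‖² / 2)`. -/
def gauss (x : EuclideanSpace ℝ (Fin d)) : ℝ := Real.exp (-(1 / 2) * ‖x‖ ^ 2)

theorem integrable_inner_pow_mul_gauss [NeZero d] (ξ : EuclideanSpace ℝ (Fin d)) (n : ℕ) :
    Integrable fun x => inner ℝ x ξ ^ n * gauss x := by
  have h0 : Integrable fun x : EuclideanSpace ℝ (Fin d) => ‖x‖ ^ n * gauss x := by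
    refine (integrable_fun_norm_addHaar volume
      (f := fun y : ℝ => y ^ n * Real.exp (-(1 / 2) * y ^ 2))).2 ?_
    have h := integrableOn_rpow_mul_exp_neg_mul_sq (b := 1 / 2) (by norm_num)
      (s := ((d - 1 + n : ℕ) : ℝ)) (lt_of_lt_of_le (by norm_num) (Nat.cast_nonneg _))
    refine h.congr_fun (fun y _ => ?_) measurableSet_Ioi
    simp only [Real.rpow_natCast, finrank_euclideanSpace_fin, smul_eq_mul, pow_add, mul_assoc]
  refine (h0.const_mul (‖ξ‖ ^ n)).mono' ?_ (Eventually.of_forall fun x => ?_)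
  · exact Continuous.aestronglyMeasurable (by unfold gauss; fun_prop)
  · have hg : 0 < gauss x := Real.exp_pos _
    rw [norm_mul, norm_pow, Real.norm_of_nonneg hg.le, ← mul_assoc, ← mul_pow, mul_comm ‖ξ‖]
    gcongr
    exact norm_inner_le_norm x ξ

/-- Recursion for the moments of the Gaussian, by parts: `∂_ξ e^{-|x|²/2} = -(x·ξ) e^{-|x|²/2}`. -/
theorem integral_inner_pow_mul_gauss_succ [NeZero d] (ξ : EuclideanSpace ℝ (Fin d)) (m : ℕ) :
    ∫ x, inner ℝ x ξ ^ (2 * (m + 1)) * gauss x =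
      (2 * m + 1) * ‖ξ‖ ^ 2 * ∫ x, inner ℝ x ξ ^ (2 * m) * gauss x := by
  have hf : ∀ x, HasLineDerivAt ℝ (fun y : EuclideanSpace ℝ (Fin d) => inner ℝ y ξ ^ (2 * m + 1))
      ((2 * m + 1) * inner ℝ x ξ ^ (2 * m) * ‖ξ‖ ^ 2) x ξ := by
    intro x
    have h1 : HasDerivAt (fun t : ℝ => x + t • ξ) ξ 0 := by
      simpa using ((hasDerivAt_id (0 : ℝ)).smul_const ξ).const_add x
    have h2 := (h1.inner ℝ (hasDerivAt_const (0 : ℝ) ξ)).fun_pow (2 * m + 1)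
    refine HasDerivAt.congr_deriv h2 ?_
    simp
  have hg : ∀ x, HasLineDerivAt ℝ (gauss : EuclideanSpace ℝ (Fin d) → ℝ)
      (-(inner ℝ x ξ * gauss x)) x ξ := by
    intro x
    have h1 : HasDerivAt (fun t : ℝ => x + t • ξ) ξ 0 := by
      simpa using ((hasDerivAt_id (0 : ℝ)).smul_const ξ).const_add x
    have h2 := (h1.norm_sq.const_mul (-(1 / 2))).exp
    refine HasDerivAt.congr_deriv h2 ?_
    simp only [zero_smul, add_zero, gauss]
    ring
  have h := integral_bilinear_hasLineDerivAt_right_eq_neg_left_of_integrable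
    (μ := (volume : Measure (EuclideanSpace ℝ (Fin d)))) (B := ContinuousLinearMap.mul ℝ ℝ)
    (v := ξ) (f := fun y => inner ℝ y ξ ^ (2 * m + 1))
    (f' := fun x => (2 * m + 1) * inner ℝ x ξ ^ (2 * m) * ‖ξ‖ ^ 2) (g := gauss)
    (g' := fun x => -(inner ℝ x ξ * gauss x))
    (((integrable_inner_pow_mul_gauss ξ (2 * m)).const_mul ((2 * m + 1) * ‖ξ‖ ^ 2)).congr
      (Eventually.of_forall fun x => by simp only [ContinuousLinearMap.mul_apply']; ring))
    ((integrable_inner_pow_mul_gauss ξ (2 * m + 2)).neg.congr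
      (Eventually.of_forall fun x => by
        simp only [ContinuousLinearMap.mul_apply', Pi.neg_apply]; ring))
    (integrable_inner_pow_mul_gauss ξ (2 * m + 1)) (fun x _ => hf x) (fun x _ => hg x)
  simp only [ContinuousLinearMap.mul_apply'] at h
  rw [← integral_const_mul, ← neg_inj]
  calc _ = ∫ x, inner ℝ x ξ ^ (2 * m + 1) * -(inner ℝ x ξ * gauss x) := by
        rw [← integral_neg]
        congr 1 with x
        ring
    _ = _ := by
        rw [h]
        congr 2 with x
        ring

/-- The radial Gaussian moments satisfy `R_{m+1} = (d + 2m) R_m`, by the functional equation of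
the Gamma function. -/
theorem radial_moment_succ [NeZero d] (m : ℕ) :
    ∫ y in Set.Ioi (0 : ℝ), y ^ (d - 1) • (y ^ (2 * (m + 1)) * Real.exp (-(1 / 2) * y ^ 2)) =
      (d + 2 * m) *
        ∫ y in Set.Ioi (0 : ℝ), y ^ (d - 1) • (y ^ (2 * m) * Real.exp (-(1 / 2) * y ^ 2)) := by
  have hd : 0 < d := Nat.pos_of_ne_zero (NeZero.ne d)
  have hdR : (0 : ℝ) < d := by exact_mod_cast hd
  have key : ∀ n : ℕ, ∫ y in Set.Ioi (0 : ℝ), y ^ (d - 1) • (y ^ (2 * n) *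
      Real.exp (-(1 / 2) * y ^ 2)) =
      (1 / 2 : ℝ) ^ (-((d : ℝ) / 2 + n)) * (1 / 2) * Real.Gamma ((d : ℝ) / 2 + n) := by
    intro n
    have h := integral_rpow_mul_exp_neg_mul_rpow (p := 2) (q := ((d - 1 + 2 * n : ℕ) : ℝ))
      (b := 1 / 2) (by norm_num) (lt_of_lt_of_le (by norm_num) (Nat.cast_nonneg _)) (by norm_num)
    have hq : (((d - 1 + 2 * n : ℕ) : ℝ) + 1) / 2 = (d : ℝ) / 2 + n := by
      push_cast [Nat.cast_sub hd]
      ring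
    rw [neg_div, hq] at h
    rw [← h]
    refine setIntegral_congr_fun measurableSet_Ioi fun y _ => ?_
    simp only [smul_eq_mul, Real.rpow_natCast, pow_add, Real.rpow_ofNat, mul_assoc]
  rw [key, key]
  have h1 : (d : ℝ) / 2 + ((m + 1 : ℕ) : ℝ) = ((d : ℝ) / 2 + m) + 1 := by push_cast; ring
  rw [h1, Real.Gamma_add_one (by positivity), neg_add, Real.rpow_add (by norm_num),
    Real.rpow_neg_one]
  ring

theorem radial_moment_pos [NeZero d] :
    0 < ∫ y in Set.Ioi (0 : ℝ), y ^ (d - 1) • (y ^ (2 * 0) * Real.exp (-(1 / 2) * y ^ 2)) := by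
  have h := integral_rpow_mul_exp_neg_mul_rpow (p := 2) (q := ((d - 1 : ℕ) : ℝ))
      (b := 1 / 2) (by norm_num) (lt_of_lt_of_le (by norm_num) (Nat.cast_nonneg _)) (by norm_num)
  simp only [Real.rpow_natCast, Real.rpow_ofNat] at h
  simp only [mul_zero, pow_zero, one_mul, smul_eq_mul, h]
  have := Real.Gamma_pos_of_pos (s := (((d - 1 : ℕ) : ℝ) + 1) / 2) (by positivity)
  positivity

/-- The even moments of the uniform measure on the sphere. Both sides are evaluated from the
Gaussian integral of `(x·ξ)^{2m}`, by parts and in polar coordinates. -/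
theorem prod_mul_integral_sphere_inner_pow [NeZero d] (ξ : EuclideanSpace ℝ (Fin d)) (m : ℕ) :
    (∏ j ∈ Finset.range m, ((d : ℝ) + 2 * j)) *
      ∫ θ, inner ℝ ξ (θ : EuclideanSpace ℝ (Fin d)) ^ (2 * m)
        ∂(volume : Measure (EuclideanSpace ℝ (Fin d))).toSphere =
    (∏ j ∈ Finset.range m, (2 * (j : ℝ) + 1)) * ‖ξ‖ ^ (2 * m) *
      (volume : Measure (EuclideanSpace ℝ (Fin d))).toSphere.real Set.univ := by
  set σ := (volume : Measure (EuclideanSpace ℝ (Fin d))).toSphere with hσ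
  let R : ℕ → ℝ := fun m =>
    ∫ y in Set.Ioi (0 : ℝ), y ^ (d - 1) • (y ^ (2 * m) * Real.exp (-(1 / 2) * y ^ 2))
  have hσpos : 0 < σ.real Set.univ := by
    rw [measureReal_def]
    exact ENNReal.toReal_pos
      (by rw [Ne, Measure.measure_univ_eq_zero]; exact Measure.toSphere_ne_zero _)
      (measure_ne_top _ _)
  have hR : ∀ n, R n = (∏ j ∈ Finset.range n, ((d : ℝ) + 2 * j)) * R 0 := by
    intro n
    induction n with
    | zero => simp
    | succ n ih =>
      rw [Finset.prod_range_succ, mul_comm (∏ j ∈ Finset.range n, _), mul_assoc, ← ih]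
      exact radial_moment_succ n
  -- the radial factor in polar coordinates is found by comparing with a radial function
  have hrad : ∀ n, ∫ ρ : Set.Ioi (0 : ℝ), (ρ : ℝ) ^ (2 * n) * Real.exp (-(1 / 2) * (ρ : ℝ) ^ 2)
      ∂Measure.volumeIoiPow (d - 1) = R n := by
    intro n
    have h1 := integral_eq_of_polar (d := d)
      (fun x => ‖x‖ ^ (2 * n) * Real.exp (-(1 / 2) * ‖x‖ ^ 2)) (fun _ => 1)
      (fun ρ => ρ ^ (2 * n) * Real.exp (-(1 / 2) * ρ ^ 2)) fun ρ hρ θ => by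
        rw [norm_smul, norm_eq_of_mem_sphere, mul_one, Real.norm_of_nonneg (le_of_lt hρ), one_mul]
    have h2 := integral_fun_norm_addHaar (volume : Measure (EuclideanSpace ℝ (Fin d)))
      (fun y => y ^ (2 * n) * Real.exp (-(1 / 2) * y ^ 2))
    rw [h1, ← smul_assoc, nsmul_eq_mul, ← Measure.toSphere_real_apply_univ, integral_const,
      smul_eq_mul, smul_eq_mul, mul_one, finrank_euclideanSpace_fin] at h2
    exact mul_left_cancel₀ hσpos.ne' h2
  have hJ : ∀ n, ∫ x, inner ℝ x ξ ^ (2 * n) * gauss x =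
      (∫ θ, inner ℝ ξ (θ : EuclideanSpace ℝ (Fin d)) ^ (2 * n) ∂σ) * R n := by
    intro n
    rw [← hrad]
    refine integral_eq_of_polar _ _ (fun ρ => ρ ^ (2 * n) * Real.exp (-(1 / 2) * ρ ^ 2))
      fun ρ hρ θ => ?_
    rw [gauss, norm_smul, norm_eq_of_mem_sphere, mul_one, Real.norm_of_nonneg (le_of_lt hρ),
      real_inner_smul_left, real_inner_comm]
    ring
  have hG : ∀ n, ∫ x, inner ℝ x ξ ^ (2 * n) * gauss x =
      (∏ j ∈ Finset.range n, (2 * (j : ℝ) + 1)) * ‖ξ‖ ^ (2 * n) * (σ.real Set.univ * R 0) := by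
    intro n
    induction n with
    | zero =>
      rw [hJ 0]
      simp
    | succ n ih =>
      rw [integral_inner_pow_mul_gauss_succ, ih, Finset.prod_range_succ]
      ring
  have h := hJ m
  rw [hG, hR m] at h
  have hR0 : R 0 ≠ 0 := radial_moment_pos.ne'
  refine mul_right_cancel₀ hR0 ?_
  linarith

variable {r : ℝ}

/-! ### The volume of `Ω` in balls controls exit times -/

/-- The surface measure on the unit sphere of `ℝ^d`. -/
abbrev surface (d : ℕ) : Measure (Metric.sphere (0 : EuclideanSpace ℝ (Fin d)) 1) :=
  (volume : Measure (EuclideanSpace ℝ (Fin d))).toSphere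

theorem surface_real_univ_pos [NeZero d] : 0 < (surface d).real Set.univ := by
  rw [measureReal_def]
  exact ENNReal.toReal_pos
    (by rw [Ne, Measure.measure_univ_eq_zero]; exact Measure.toSphere_ne_zero _)
    (measure_ne_top _ _)

theorem measurable_invExit_sphere (hΩ : IsOpen Ω) (x : EuclideanSpace ℝ (Fin d)) :
    Measurable fun θ : Metric.sphere (0 : EuclideanSpace ℝ (Fin d)) 1 => invExit Ω θ x :=
  measurable_subtype_coe.invExit hΩ measurable_const

/-- The part of `Ω ∩ B_r(x)` which is visible from `x`, in polar coordinates. The radius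
`r / max 1 (r w)` is the minimum of `r` and of the exit time `1 / w`. -/
theorem lintegral_visible_le [NeZero d] (hΩ : IsOpen Ω) (hx : x ∈ Ω) (hr : 0 < r) :
    ∫⁻ θ : Metric.sphere (0 : EuclideanSpace ℝ (Fin d)) 1,
      ENNReal.ofReal ((r / max 1 (r * invExit Ω θ x)) ^ d / d) ∂surface d ≤
      volume (Ω ∩ Metric.ball x r) := by
  have hd : 0 < d := Nat.pos_of_ne_zero (NeZero.ne d)
  have hmax : ∀ θ, 0 < max 1 (r * invExit Ω θ x) := fun θ => lt_max_of_lt_left one_pos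
  let A : Set (Metric.sphere (0 : EuclideanSpace ℝ (Fin d)) 1 × Set.Ioi (0 : ℝ)) :=
    {p | (p.2 : ℝ) < r / max 1 (r * invExit Ω p.1 x)}
  have hA : MeasurableSet A := by
    refine measurableSet_lt (measurable_subtype_coe.comp measurable_snd) (measurable_const.div ?_)
    exact measurable_const.max (measurable_const.mul
      ((measurable_subtype_coe.comp measurable_fst).invExit hΩ measurable_const))
  have hp := (volume : Measure (EuclideanSpace ℝ (Fin d)))
    |>.measurePreserving_homeomorphUnitSphereProd
  rw [finrank_euclideanSpace_fin] at hp
  have h1 : ∫⁻ θ : Metric.sphere (0 : EuclideanSpace ℝ (Fin d)) 1,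
      ENNReal.ofReal ((r / max 1 (r * invExit Ω θ x)) ^ d / d) ∂surface d =
      (surface d).prod (Measure.volumeIoiPow (d - 1)) A := by
    rw [Measure.prod_apply hA]
    refine lintegral_congr fun θ => ?_
    have h2 : Prod.mk θ ⁻¹' A =
        Set.Iio (⟨r / max 1 (r * invExit Ω θ x), div_pos hr (hmax θ)⟩ : Set.Ioi (0 : ℝ)) := rfl
    rw [h2, Measure.volumeIoiPow_apply_Iio, Nat.sub_add_cancel hd, Nat.cast_pred hd,
      sub_add_cancel]
  rw [h1, ← hp.measure_preimage hA.nullMeasurableSet,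
    comap_subtype_coe_apply (measurableSet_singleton _).compl]
  have h3 : volume (Ω ∩ Metric.ball x r) =
      volume ((fun y => x + y) ⁻¹' (Ω ∩ Metric.ball x r)) :=
    (measure_preimage_add _ _ _).symm
  rw [h3]
  refine measure_mono ?_
  rintro _ ⟨y, hy, rfl⟩
  have hy0 : 0 < ‖(y : EuclideanSpace ℝ (Fin d))‖ := norm_pos_iff.2 y.2
  set θ := (homeomorphUnitSphereProd (EuclideanSpace ℝ (Fin d)) y).1 with hθ
  have hyA : ((homeomorphUnitSphereProd (EuclideanSpace ℝ (Fin d)) y).2 : ℝ) <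
      r / max 1 (r * invExit Ω θ x) := hy
  rw [homeomorphUnitSphereProd_apply_snd_coe] at hyA
  have hyθ : (y : EuclideanSpace ℝ (Fin d)) =
      ‖(y : EuclideanSpace ℝ (Fin d))‖ • (θ : EuclideanSpace ℝ (Fin d)) := by
    simp [hθ, smul_smul, hy0.ne']
  rw [lt_div_iff₀ (hmax θ)] at hyA
  constructor
  · change x + (y : EuclideanSpace ℝ (Fin d)) ∈ Ω
    rw [hyθ]
    refine add_smul_mem_of_mul_invExit_lt hΩ hx hy0 ?_
    have h4 : ‖(y : EuclideanSpace ℝ (Fin d))‖ * (r * invExit Ω θ x) < r :=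
      (mul_le_mul_of_nonneg_left (le_max_right _ _) hy0.le).trans_lt hyA
    refine lt_of_mul_lt_mul_left ?_ hr.le
    linarith
  · change x + (y : EuclideanSpace ℝ (Fin d)) ∈ Metric.ball x r
    rw [Metric.mem_ball, dist_self_add_left]
    calc ‖(y : EuclideanSpace ℝ (Fin d))‖
        = ‖(y : EuclideanSpace ℝ (Fin d))‖ * 1 := (mul_one _).symm
      _ ≤ _ := mul_le_mul_of_nonneg_left (le_max_left _ _) hy0.le
      _ < r := hyA

theorem Psi_le_one (Ω : Set (EuclideanSpace ℝ (Fin d))) (r : ℝ) : Psi Ω r ≤ 1 :=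
  iSup₂_le fun _ _ => ENNReal.div_le_of_le_mul (by
    rw [one_mul]
    exact measure_mono Set.inter_subset_right)

theorem volume_inter_ball_le (hx : x ∈ Ω) (hr : 0 < r) :
    volume (Ω ∩ Metric.ball x r) ≤ Psi Ω r * volume (Metric.ball x r) := by
  rw [← ENNReal.div_le_iff (Metric.measure_ball_pos volume x hr).ne' measure_ball_lt_top.ne]
  exact le_iSup₂ (f := fun x _ => volume (Ω ∩ Metric.ball x r) / volume (Metric.ball x r)) x hx

theorem Psi_pos (hΩ : IsOpen Ω) (hx : x ∈ Ω) (hr : 0 < r) : 0 < Psi Ω r := by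
  have h := volume_inter_ball_le hx hr
  have h2 : 0 < volume (Ω ∩ Metric.ball x r) :=
    (hΩ.inter Metric.isOpen_ball).measure_pos volume ⟨x, hx, Metric.mem_ball_self hr⟩
  rw [pos_iff_ne_zero]
  intro h0
  rw [h0, zero_mul] at h
  exact absurd h (not_le.2 h2)

theorem integral_visible_le [NeZero d] (hΩ : IsOpen Ω) (hx : x ∈ Ω) (hr : 0 < r) :
    ∫ θ : Metric.sphere (0 : EuclideanSpace ℝ (Fin d)) 1,
      (max 1 (r * invExit Ω θ x) ^ d)⁻¹ ∂surface d ≤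
      (Psi Ω r).toReal * (surface d).real Set.univ := by
  have hd : (0 : ℝ) < d := by exact_mod_cast Nat.pos_of_ne_zero (NeZero.ne d)
  have hPsi : Psi Ω r ≠ ⊤ := ((Psi_le_one Ω r).trans_lt ENNReal.one_lt_top).ne
  have hmeas : Measurable fun θ : Metric.sphere (0 : EuclideanSpace ℝ (Fin d)) 1 =>
      (max 1 (r * invExit Ω θ x) ^ d)⁻¹ :=
    ((measurable_const.max (measurable_const.mul (measurable_invExit_sphere hΩ x))).pow_const d).inv
  rw [integral_eq_lintegral_of_nonneg_ae (Eventually.of_forall fun θ => by positivity)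
    hmeas.aestronglyMeasurable, measureReal_def, ← ENNReal.toReal_mul]
  refine ENNReal.toReal_mono (ENNReal.mul_ne_top hPsi (measure_ne_top _ _)) ?_
  have h := (lintegral_visible_le hΩ hx hr).trans (volume_inter_ball_le hx hr)
  have h1 : ∀ θ : Metric.sphere (0 : EuclideanSpace ℝ (Fin d)) 1,
      ENNReal.ofReal ((r / max 1 (r * invExit Ω θ x)) ^ d / d) =
      ENNReal.ofReal (r ^ d / d) * ENNReal.ofReal ((max 1 (r * invExit Ω θ x) ^ d)⁻¹) := by
    intro θ
    rw [← ENNReal.ofReal_mul (by positivity), div_pow]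
    congr 1
    ring
  simp only [h1] at h
  rw [lintegral_const_mul _ hmeas.ennreal_ofReal, Measure.addHaar_ball volume x hr.le,
    finrank_euclideanSpace_fin] at h
  have h2 : ENNReal.ofReal (r ^ d) = ENNReal.ofReal (r ^ d / d) * d := by
    rw [← ENNReal.ofReal_natCast d, ← ENNReal.ofReal_mul (by positivity), div_mul_cancel₀ _ hd.ne']
  rw [h2, mul_left_comm, mul_assoc, mul_left_comm] at h
  have h3 := (ENNReal.mul_le_mul_iff_right
    (ENNReal.ofReal_pos.2 (by positivity : 0 < r ^ d / d)).ne' ENNReal.ofReal_ne_top).1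
    (h.trans_eq (mul_left_comm _ _ _))
  rwa [Measure.toSphere_apply_univ, finrank_euclideanSpace_fin, mul_left_comm]

theorem integrable_invExit_pow_sphere (hΩ : IsOpen Ω) (hx : x ∈ Ω) (n : ℕ) :
    Integrable (fun θ : Metric.sphere (0 : EuclideanSpace ℝ (Fin d)) 1 => invExit Ω θ x ^ n)
      (surface d) := by
  obtain ⟨B, hB0, hB⟩ := exists_invExit_le hΩ isCompact_singleton (Set.singleton_subset_iff.2 hx)
  refine Integrable.of_bound ((measurable_invExit_sphere hΩ x).pow_const n).aestronglyMeasurable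
    (B ^ n) (Eventually.of_forall fun θ => ?_)
  rw [Real.norm_of_nonneg (pow_nonneg invExit_nonneg n)]
  exact pow_le_pow_left₀ invExit_nonneg (hB θ (norm_eq_of_mem_sphere θ) x rfl) n

/-- A pointwise bound `y^{2m} ≥ α - β τ`, where `τ = (max 1 y)^{-d}`, gives a lower bound for the
spherical mean of `w^{2m}`, since the mean of `τ` is at most `Ψ_r`. -/
theorem le_integral_invExit_pow [NeZero d] (hΩ : IsOpen Ω) (hx : x ∈ Ω) (hr : 0 < r) {m : ℕ}
    {α β : ℝ} (hβ : 0 ≤ β) (hy : ∀ y : ℝ, 0 ≤ y → α - β * (max 1 y ^ d)⁻¹ ≤ y ^ (2 * m)) :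
    (α - β * (Psi Ω r).toReal) * (surface d).real Set.univ ≤
      r ^ (2 * m) * ∫ θ : Metric.sphere (0 : EuclideanSpace ℝ (Fin d)) 1,
        invExit Ω θ x ^ (2 * m) ∂surface d := by
  have hτ : Integrable (fun θ : Metric.sphere (0 : EuclideanSpace ℝ (Fin d)) 1 =>
      (max 1 (r * invExit Ω θ x) ^ d)⁻¹) (surface d) := by
    refine Integrable.of_bound ((measurable_const.max (measurable_const.mul
      (measurable_invExit_sphere hΩ x))).pow_const d).inv.aestronglyMeasurable
      1 (Eventually.of_forall fun θ => ?_)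
    rw [Real.norm_of_nonneg (by positivity)]
    exact inv_le_one_of_one_le₀ (one_le_pow₀ (le_max_left _ _))
  have h1 := integral_mono ((integrable_const α).sub (hτ.const_mul β))
    ((integrable_invExit_pow_sphere hΩ hx (2 * m)).const_mul (r ^ (2 * m))) fun θ => by
      rw [← mul_pow]
      exact hy _ (mul_nonneg hr.le invExit_nonneg)
  simp only [Pi.sub_apply] at h1
  rw [integral_sub (integrable_const α) (hτ.const_mul β), integral_const_mul, integral_const_mul,
    integral_const, smul_eq_mul] at h1
  have h2 := mul_le_mul_of_nonneg_left (integral_visible_le hΩ hx hr) hβ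
  linarith

/-! ### Averaging the directional inequalities over the sphere -/

theorem continuous_inner_pow_mul_fourierSq (φ : testFunctions Ω) (m : ℕ) :
    Continuous fun p : EuclideanSpace ℝ (Fin d) × Metric.sphere (0 : EuclideanSpace ℝ (Fin d)) 1 =>
      (2 * Real.pi * inner ℝ p.1 (p.2 : EuclideanSpace ℝ (Fin d))) ^ (2 * m) *
        fourierSq φ p.1 := by
  have := continuous_fourierSq φ
  fun_prop

/-- The form, written on the Fourier side, is a multiple of the spherical mean of the directional
forms. -/
theorem prod_mul_integral_directional [NeZero d] (φ : testFunctions Ω) (m : ℕ) :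
    Integrable (fun θ : Metric.sphere (0 : EuclideanSpace ℝ (Fin d)) 1 =>
      ∫ x, ‖((testDeriv (θ : EuclideanSpace ℝ (Fin d)))^[m] φ).1 x‖ ^ 2) (surface d) ∧
    (∏ j ∈ Finset.range m, ((d : ℝ) + 2 * j)) *
      ∫ θ : Metric.sphere (0 : EuclideanSpace ℝ (Fin d)) 1,
        (∫ x, ‖((testDeriv (θ : EuclideanSpace ℝ (Fin d)))^[m] φ).1 x‖ ^ 2) ∂surface d =
    (∏ j ∈ Finset.range m, (2 * (j : ℝ) + 1)) * (surface d).real Set.univ *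
      ∫ ξ, (2 * Real.pi * ‖ξ‖) ^ (2 * m) * fourierSq φ ξ := by
  have hint : Integrable (fun p : EuclideanSpace ℝ (Fin d) ×
      Metric.sphere (0 : EuclideanSpace ℝ (Fin d)) 1 =>
      (2 * Real.pi * inner ℝ p.1 (p.2 : EuclideanSpace ℝ (Fin d))) ^ (2 * m) *
        fourierSq φ p.1) (volume.prod (surface d)) := by
    refine ((integrable_pow_mul_fourierSq φ (2 * m)).comp_fst (surface d)).mono'
      (continuous_inner_pow_mul_fourierSq φ m).aestronglyMeasurable
      (Eventually.of_forall fun p => ?_)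
    rw [norm_mul, Real.norm_of_nonneg (fourierSq_nonneg φ p.1), norm_pow]
    refine mul_le_mul_of_nonneg_right (pow_le_pow_left₀ (norm_nonneg _) ?_ _)
      (fourierSq_nonneg φ p.1)
    rw [norm_mul, Real.norm_of_nonneg (by positivity : 0 ≤ 2 * Real.pi)]
    have h := norm_inner_le_norm (𝕜 := ℝ) p.1 (p.2 : EuclideanSpace ℝ (Fin d))
    rw [norm_eq_of_mem_sphere, mul_one] at h
    exact mul_le_mul_of_nonneg_left h (by positivity)
  simp only [integral_norm_sq_testFunction, fourierSq_iterate_testDeriv]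
  refine ⟨hint.integral_prod_right, ?_⟩
  rw [← integral_integral_swap hint, ← integral_const_mul, ← integral_const_mul]
  congr 1 with ξ
  have h := prod_mul_integral_sphere_inner_pow ξ m
  simp only [mul_pow]
  rw [integral_mul_const, integral_const_mul]
  linear_combination ((2 : ℝ) ^ (2 * m) * Real.pi ^ (2 * m)) * fourierSq φ ξ * h

theorem testFunctions_memLp_volume (φ : testFunctions Ω) : MemLp φ.1 2 volume :=
  φ.2.1.continuous.memLp_of_hasCompactSupport φ.2.2.1

theorem integrable_norm_sq_testFunction (φ : testFunctions Ω) :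
    Integrable fun x => ‖φ.1 x‖ ^ 2 := by
  simpa [← integral_norm_sq_testFunction] using
    (testFunctions_memLp_volume φ).integrable_norm_pow two_ne_zero

theorem integrable_norm_sq_mul_invExit (hΩ : IsOpen Ω) (φ : testFunctions Ω) (n : ℕ) :
    Integrable (fun p : EuclideanSpace ℝ (Fin d) ×
      Metric.sphere (0 : EuclideanSpace ℝ (Fin d)) 1 => ‖φ.1 p.1‖ ^ 2 * invExit Ω p.2 p.1 ^ n)
      (volume.prod (surface d)) := by
  have hK : IsCompact (tsupport φ.1) := φ.2.2.1
  obtain ⟨B, hB0, hB⟩ := exists_invExit_le hΩ hK φ.2.2.2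
  have hc : Continuous fun x => ‖φ.1 x‖ ^ 2 := φ.2.1.continuous.norm.pow 2
  have hφ := integrable_norm_sq_testFunction φ
  have hw : Measurable fun p : EuclideanSpace ℝ (Fin d) ×
      Metric.sphere (0 : EuclideanSpace ℝ (Fin d)) 1 => invExit Ω p.2 p.1 :=
    (measurable_subtype_coe.comp measurable_snd).invExit hΩ measurable_fst
  refine ((hφ.mul_const (B ^ n)).comp_fst (surface d)).mono'
    ((hc.measurable.comp measurable_fst).mul (hw.pow_const n)).aestronglyMeasurable
    (Eventually.of_forall fun p => ?_)
  have h0 : 0 ≤ invExit Ω p.2 p.1 ^ n := pow_nonneg invExit_nonneg n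
  rw [Real.norm_of_nonneg (by positivity)]
  by_cases hp : p.1 ∈ tsupport φ.1
  · exact mul_le_mul_of_nonneg_left
      (pow_le_pow_left₀ invExit_nonneg (hB p.2 (norm_eq_of_mem_sphere p.2) _ hp) n) (sq_nonneg _)
  · simp [image_eq_zero_of_notMem_tsupport hp]

/-- The form inequality on test functions, with the constant coming from a pointwise bound
`y^{2m} ≥ α - β (max 1 y)^{-d}`. -/
theorem bigC_mul_integral_le [NeZero d] (hΩ : IsOpen Ω) (hr : 0 < r) {m : ℕ}
    {α β : ℝ} (hβ : 0 ≤ β) (hy : ∀ y : ℝ, 0 ≤ y → α - β * (max 1 y ^ d)⁻¹ ≤ y ^ (2 * m))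
    (φ : testFunctions Ω) :
    bigC m d * (1 / r ^ (2 * m)) * (α - β * (Psi Ω r).toReal) * ∫ x, ‖φ.1 x‖ ^ 2 ≤
      ∫ ξ, (2 * Real.pi * ‖ξ‖) ^ (2 * m) * fourierSq φ ξ := by
  have hd : (0 : ℝ) < d := by exact_mod_cast Nat.pos_of_ne_zero (NeZero.ne d)
  have hw := integrable_norm_sq_mul_invExit hΩ φ (2 * m)
  obtain ⟨hdir, hdir'⟩ := prod_mul_integral_directional φ m
  set S := (surface d).real Set.univ
  have hS : 0 < S := surface_real_univ_pos
  set P := ∏ j ∈ Finset.range m, ((d : ℝ) + 2 * j) with hP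
  set Q := ∏ j ∈ Finset.range m, (2 * (j : ℝ) + 1) with hQ
  have hPpos : 0 < P := Finset.prod_pos fun j _ => by positivity
  have hQpos : 0 < Q := Finset.prod_pos fun j _ => by positivity
  set A := ∏ k ∈ Finset.range m, ((2 * (k : ℝ) + 1) / 2) ^ 2 with hA
  have hAQ : A = Q ^ 2 / 4 ^ m := by
    simp only [hA, hQ, div_pow, Finset.prod_div_distrib, Finset.prod_pow, Finset.prod_const,
      Finset.card_range]
    rw [← pow_mul, mul_comm m 2, pow_mul]
    norm_num
  set I := ∫ x, ‖φ.1 x‖ ^ 2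
  -- Birman's inequality, averaged over all directions
  have h1 : A * ∫ θ : Metric.sphere (0 : EuclideanSpace ℝ (Fin d)) 1,
      (∫ x, ‖φ.1 x‖ ^ 2 * invExit Ω θ x ^ (2 * m)) ∂surface d ≤
      ∫ θ : Metric.sphere (0 : EuclideanSpace ℝ (Fin d)) 1,
        (∫ x, ‖((testDeriv (θ : EuclideanSpace ℝ (Fin d)))^[m] φ).1 x‖ ^ 2) ∂surface d := by
    rw [← integral_const_mul]
    exact integral_mono (hw.integral_prod_right.const_mul A) hdir fun θ =>
      birman hΩ (norm_eq_of_mem_sphere θ) m φ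
  -- the averaged weight is bounded below on `Ω`
  have h2 : (α - β * (Psi Ω r).toReal) * S * I ≤ r ^ (2 * m) *
      ∫ θ : Metric.sphere (0 : EuclideanSpace ℝ (Fin d)) 1,
        (∫ x, ‖φ.1 x‖ ^ 2 * invExit Ω θ x ^ (2 * m)) ∂surface d := by
    rw [← integral_integral_swap hw, ← integral_const_mul, ← integral_const_mul]
    refine integral_mono ((integrable_norm_sq_testFunction φ).const_mul _)
      (hw.integral_prod_left.const_mul _) fun x => ?_
    simp only
    rw [integral_const_mul]
    by_cases hx : x ∈ Ω
    · have h := mul_le_mul_of_nonneg_left (le_integral_invExit_pow hΩ hx hr hβ hy)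
        (sq_nonneg ‖φ.1 x‖)
      linarith
    · simp [testFunctions_eq_zero_of_notMem φ hx]
  have h3 : P * A * ((α - β * (Psi Ω r).toReal) * S * I) ≤ r ^ (2 * m) * (Q * S *
      ∫ ξ, (2 * Real.pi * ‖ξ‖) ^ (2 * m) * fourierSq φ ξ) := by
    rw [← hdir']
    have h4 := mul_le_mul_of_nonneg_left h2 (by positivity : 0 ≤ P * A)
    have h5 := mul_le_mul_of_nonneg_left h1 (by positivity : 0 ≤ r ^ (2 * m) * P)
    linarith
  have hrm : 0 < r ^ (2 * m) := by positivity
  have h6 : bigC m d * (1 / r ^ (2 * m)) * (α - β * (Psi Ω r).toReal) * I =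
      P * A * ((α - β * (Psi Ω r).toReal) * S * I) / (r ^ (2 * m) * (Q * S)) := by
    rw [bigC, ← hP, ← hQ, hAQ]
    field_simp
  rw [h6, div_le_iff₀ (by positivity)]
  linarith

/-! ### The pointwise inequalities and the bounds on the spectrum -/

/-- The tangent line at `a` of the convex function `t ↦ t^{-s}`. -/
theorem tangent_le_rpow_neg {a t s : ℝ} (ha : 0 < a) (ht : 0 < t) (hs : 0 ≤ s) :
    a ^ (-s) * (1 + s) - a ^ (-s) * (s / a) * t ≤ t ^ (-s) := by
  have h1 : t ^ (-s) = a ^ (-s) * Real.exp (-s * Real.log (t / a)) := by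
    rw [Real.rpow_def_of_pos ht, Real.rpow_def_of_pos ha, ← Real.exp_add,
      Real.log_div ht.ne' ha.ne']
    ring_nf
  have h2 := Real.add_one_le_exp (-s * Real.log (t / a))
  have h3 := mul_le_mul_of_nonneg_left (Real.log_le_sub_one_of_pos (div_pos ht ha)) hs
  have h4 : 1 + s - s / a * t ≤ Real.exp (-s * Real.log (t / a)) := by
    refine le_trans ?_ h2
    have : s / a * t = s * (t / a) := by ring
    linarith
  rw [h1]
  have h5 := mul_le_mul_of_nonneg_left h4 (Real.rpow_pos_of_pos ha (-s)).le
  linarith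

theorem inv_pow_rpow_neg [NeZero d] {z : ℝ} (hz : 0 < z) (m : ℕ) :
    ((z ^ d)⁻¹ : ℝ) ^ (-(2 * (m : ℝ) / d)) = z ^ (2 * m) := by
  have hd : (d : ℝ) ≠ 0 := by exact_mod_cast NeZero.ne d
  rw [Real.rpow_neg (by positivity), Real.inv_rpow (by positivity), inv_inv, ← Real.rpow_natCast,
    ← Real.rpow_mul hz.le, mul_div_cancel₀ _ hd, ← Real.rpow_natCast]
  push_cast
  rfl

theorem tangent_le_pow [NeZero d] {a : ℝ} (ha : 0 < a) (m : ℕ) (y : ℝ) :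
    a ^ (-(2 * (m : ℝ) / d)) * (1 + 2 * (m : ℝ) / d) -
      a ^ (-(2 * (m : ℝ) / d)) * (2 * (m : ℝ) / d / a) * (max 1 y ^ d)⁻¹ ≤ max 1 y ^ (2 * m) := by
  have hz : 0 < max 1 y := lt_max_of_lt_left one_pos
  rw [← inv_pow_rpow_neg (d := d) hz m]
  exact tangent_le_rpow_neg ha (by positivity) (by positivity)

theorem bigC_mul_le_lambda [NeZero d] (hΩ : IsOpen Ω) (hr : 0 < r) {m : ℕ} {α β : ℝ}
    (hβ : 0 ≤ β) (hy : ∀ y : ℝ, 0 ≤ y → α - β * (max 1 y ^ d)⁻¹ ≤ y ^ (2 * m)) :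
    ((bigC m d * (1 / r ^ (2 * m)) * (α - β * (Psi Ω r).toReal) : ℝ) : EReal) ≤ lambda Ω m :=
  le_lambda hΩ (bigC_mul_integral_le hΩ hr hβ hy)

theorem le_lambda_Psi_rpow [NeZero d] (hΩ : IsOpen Ω) (hne : Ω.Nonempty) (hr : 0 < r) (m : ℕ) :
    ((bigC m d * (1 / r ^ (2 * m)) : ℝ) : EReal) *
      (((Psi Ω r ^ (-(2 * (m : ℝ) / d)) : ℝ≥0∞) : EReal) - 1) ≤ lambda Ω m := by
  obtain ⟨x, hx⟩ := hne
  have hPsi : Psi Ω r ≠ ⊤ := ((Psi_le_one Ω r).trans_lt ENNReal.one_lt_top).ne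
  have ha : 0 < (Psi Ω r).toReal := ENNReal.toReal_pos (Psi_pos hΩ hx hr).ne' hPsi
  -- the tangent line is taken at the value `Ψ_r` that bounds the mean
  have h := bigC_mul_le_lambda (m := m) (Ω := Ω) hΩ hr
    (α := (Psi Ω r).toReal ^ (-(2 * (m : ℝ) / d)) * (1 + 2 * (m : ℝ) / d) - 1)
    (β := (Psi Ω r).toReal ^ (-(2 * (m : ℝ) / d)) * (2 * (m : ℝ) / d / (Psi Ω r).toReal))
    (by positivity) fun y hy => by
      have h1 := tangent_le_pow (d := d) ha m y
      have h2 : max 1 y ^ (2 * m) - 1 ≤ y ^ (2 * m) := by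
        rcases le_total y 1 with h | h
        · rw [max_eq_left h, one_pow, sub_self]
          positivity
        · rw [max_eq_right h]
          linarith
      linarith
  refine le_trans (le_of_eq ?_) h
  have h3 : Psi Ω r ^ (-(2 * (m : ℝ) / d)) =
      ENNReal.ofReal ((Psi Ω r).toReal ^ (-(2 * (m : ℝ) / d))) := by
    rw [← ENNReal.ofReal_rpow_of_pos ha, ENNReal.ofReal_toReal hPsi]
  rw [h3, EReal.coe_ennreal_ofReal, max_eq_left (by positivity), ← EReal.coe_one, ← EReal.coe_sub,
    ← EReal.coe_mul]
  congr 2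
  field_simp
  ring

theorem le_lambda_one_sub_Psi [NeZero d] (hΩ : IsOpen Ω) (hr : 0 < r) {m : ℕ} (hm : 1 ≤ m) :
    ((smallC m d * bigC m d * (1 / r ^ (2 * m)) : ℝ) : EReal) *
      (1 - (Psi Ω r : EReal)) ≤ lambda Ω m := by
  have hd : (0 : ℝ) < d := by exact_mod_cast Nat.pos_of_ne_zero (NeZero.ne d)
  have hm' : (0 : ℝ) < m := by exact_mod_cast hm
  have hPsi : Psi Ω r ≠ ⊤ := ((Psi_le_one Ω r).trans_lt ENNReal.one_lt_top).ne
  have hc : 0 ≤ smallC m d := by unfold smallC; positivity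
  -- the tangent line is taken at `a = s / (1 + s)`, `s = 2m/d`, where it vanishes at `t = 1`
  have h := bigC_mul_le_lambda (m := m) (Ω := Ω) hΩ hr (α := smallC m d) (β := smallC m d) hc
    fun y hy => by
      rcases le_total y 1 with h | h
      · rw [max_eq_left h, one_pow, inv_one, mul_one, sub_self]
        positivity
      · have h1 := tangent_le_pow (d := d) (a := 2 * (m : ℝ) / (d + 2 * m)) (by positivity) m y
        have h2 : (2 * (m : ℝ) / (d + 2 * m)) ^ (-(2 * (m : ℝ) / d)) =
            (((d : ℝ) + 2 * m) / (2 * m)) ^ (2 * (m : ℝ) / d) := by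
          rw [Real.rpow_neg (by positivity), ← Real.inv_rpow (by positivity), inv_div]
        have h3 : 2 * (m : ℝ) / d / (2 * (m : ℝ) / (d + 2 * m)) = (d + 2 * m) / d := by
          field_simp
        have h4 : 1 + 2 * (m : ℝ) / d = (d + 2 * m) / d := by
          field_simp
        rw [h2, h3, h4, max_eq_right h] at h1
        rwa [smallC, max_eq_right h]
  refine le_trans (le_of_eq ?_) h
  rw [← ENNReal.ofReal_toReal hPsi, EReal.coe_ennreal_ofReal, max_eq_left ENNReal.toReal_nonneg,
    ← EReal.coe_one, ← EReal.coe_sub, ← EReal.coe_mul, ENNReal.toReal_ofReal ENNReal.toReal_nonneg]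
  congr 1
  ring

theorem lambda_empty (d m : ℕ) : lambda (∅ : Set (EuclideanSpace ℝ (Fin d))) m = ⊤ := by
  rw [EReal.eq_top_iff_forall_lt]
  intro y
  refine lt_of_lt_of_le (EReal.coe_lt_coe_iff.2 (lt_add_one y)) (le_lambda isOpen_empty fun φ => ?_)
  have h : ∀ x, φ.1 x = 0 := fun x => testFunctions_eq_zero_of_notMem φ (Set.notMem_empty x)
  simp only [h, norm_zero, ne_eq, OfNat.ofNat_ne_zero, not_false_eq_true, zero_pow, integral_zero,
    mul_zero]
  exact integral_nonneg fun ξ => mul_nonneg (by positivity) (fourierSq_nonneg φ ξ)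

end Polyharmonic

end

/-- Lower bounds on the bottom of the spectrum of the Dirichlet polyharmonic operator, and the
resulting bound for the Dirichlet Laplacian. All inequalities are between extended reals. -/
theorem theorem2p2 (d : ℕ) (hd : 2 ≤ d) (Ω : Set (EuclideanSpace ℝ (Fin d))) (hΩ : IsOpen Ω) :
    (∀ m : ℕ, 1 ≤ m → ∀ r : ℝ, 0 < r →
      ((Polyharmonic.bigC m d * (1 / r ^ (2 * m)) : ℝ) : EReal) *
          (((Polyharmonic.Psi Ω r ^ (-(2 * (m : ℝ) / d)) : ℝ≥0∞) : EReal) - 1)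
        ≤ Polyharmonic.lambda Ω m ∧
      ((Polyharmonic.smallC m d * Polyharmonic.bigC m d * (1 / r ^ (2 * m)) : ℝ) : EReal) *
          (1 - (Polyharmonic.Psi Ω r : EReal))
        ≤ Polyharmonic.lambda Ω m) ∧
    ∀ r : ℝ, 0 < r →
      (((d : ℝ) / 4 * (1 / r ^ 2) : ℝ) : EReal) *
          (((Polyharmonic.Psi Ω r ^ (-(2 / (d : ℝ))) : ℝ≥0∞) : EReal) - 1)
        ≤ Polyharmonic.lambda Ω 1 := by
  have : NeZero d := ⟨by omega⟩
  have key : ∀ (m : ℕ) (r : ℝ), 0 < r →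
      ((Polyharmonic.bigC m d * (1 / r ^ (2 * m)) : ℝ) : EReal) *
          (((Polyharmonic.Psi Ω r ^ (-(2 * (m : ℝ) / d)) : ℝ≥0∞) : EReal) - 1)
        ≤ Polyharmonic.lambda Ω m := by
    intro m r hr
    rcases Ω.eq_empty_or_nonempty with rfl | hne
    · rw [Polyharmonic.lambda_empty]
      exact le_top
    · exact Polyharmonic.le_lambda_Psi_rpow hΩ hne hr m
  refine ⟨fun m hm r hr => ⟨key m r hr, Polyharmonic.le_lambda_one_sub_Psi hΩ hr hm⟩,
    fun r hr => ?_⟩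
  have h := key 1 r hr
  simpa [Polyharmonic.bigC] using h
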